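/- Let $A$ be a $C^*$-algebra (not necessarily unital), let $M$ be a correspondence over $A$ (a right Hilbert $A$-module with a left action of $A$ given by a $*$-homomorphism of $A$ into the adjointable operators on $M$), let $Y$ be a right Hilbert $A$-module, and let $T:Y\to Y\otimes_A M$ be an inner-product preserving adjointable map, where $\otimes_A$ denotes the internal tensor product: the completion of the algebraic tensor product in the inner product $\langle x\otimes m,y\otimes n\rangle=\langle m,\langle x,y\rangle\cdot n\rangle$. Tensor powers are bracketed from the left, so that $X\otimes_A M^{\otimes 0}=X$ and $X\otimes_A M^{\otimes (k+1)}=(X\otimes_A M^{\otimes k})\otimes_A M$. Put $T_k:=T\otimes\mathrm{id}_k:Y\otimes_A M^{\otimes k}\to Y\otimes_A M^{\otimes(k+1)}$, let $(Y_\infty,\iota^k)=\varinjlim(Y\otimes_A M^{\otimes k},T_k)$ be the direct limit of Hilbert modules (the completion of the algebraic direct limit), let $Y_k:=\iota^k(Y\otimes_A M^{\otimes k})\subset Y_\infty$, and let $Z_k:=Y_{k+1}\ominus Y_k$ be the set of elements of $Y_{k+1}$ orthogonal to $Y_k$. Then the following hold. (1) For every $k\ge 0$, $Y_k\subset Y_{k+1}$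 and $Y_k$ is complemented in $Y_{k+1}$ with complement $Z_k$, that is, $Y_{k+1}=Y_k+Z_k$. (2) There is a Hilbert-module direct-sum decomposition \[ Y_\infty=Y_0\oplus\Big(\bigoplus_{k=0}^\infty Z_k\Big); \] that is, let the right-hand side be the Hilbert module of all $(y,(z_k)_{k\ge0})$ with $y\in Y_0$, $z_k\in Z_k$ and $\sum_k\langle z_k,z_k\rangle$ convergent in $A$, with inner product $\langle(y,(z_k)),(y',(z_k'))\rangle=\langle y,y'\rangle+\sum_k\langle z_k,z'_k\rangle$. Then for each such element the series $\sum_k z_k$ converges in $Y_\infty$, and $(y,(z_k))\mapsto y+\sum_k z_k$ is an isomorphism of Hilbert modules onto $Y_\infty$. (3) There is exactly one Hilbert-module isomorphism $R$ of $Y_\infty$ onto $Y_\infty\otimes_A M$ such that $R\circ\iota^{k+1}=\iota^k\otimes\mathrm{id}$ for all $k\ge0$. Define $R^0=\mathrm{id}$ and $R^{k+1}=(R\otimes\mathrm{id}_k)\circ R^k:Y_\infty\to Y_\infty\otimes_A M^{\otimes(k+1)}$. Then for every $k\ge0$ the map $R^k:Y_\infty\to Y_\infty\otimes_A M^{\otimes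 k}$ is an isomorphism, and it restricts to an isomorphism of $Z_k$ onto $Z_0\otimes_A M^{\otimes k}$, where $Z_0\otimes_A M^{\otimes k}$ is regarded as a submodule of $Y_\infty\otimes_A M^{\otimes k}$ through the isometric embedding induced by the inclusion $Z_0\subset Y_\infty$. -/

import Mathlib

open MulOpposite UniformSpace
open scoped TensorProduct

universe u v w

noncomputable section

/-- A (right) Hilbert module over the C⋆-algebra `A`: a Banach space with a right action of `A`
(that is, an action of `Aᵐᵒᵖ`) and an inner product inducing the norm. Mathlib's `CStarModule B E`
is the left-handed notion (`inner x (b • y) = b * inner x y`), so a right module over `A` is a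
`CStarModule` over `Aᵐᵒᵖ`; the `A`-valued inner product is `HilbertModule.ip` below. -/
structure HilbertModule (A : Type v) [NonUnitalCStarAlgebra A] [PartialOrder A]
    [StarOrderedRing A] where
  carrier : Type u
  [normedAddCommGroup : NormedAddCommGroup carrier]
  [normedSpace : NormedSpace ℂ carrier]
  [completeSpace : CompleteSpace carrier]
  [smul : SMul Aᵐᵒᵖ carrier]
  [cstarModule : CStarModule Aᵐᵒᵖ carrier]

namespace HilbertModule

variable {A : Type v} [NonUnitalCStarAlgebra A] [PartialOrder A] [StarOrderedRing A]

instance : CoeSort (HilbertModule.{u} A) (Type u) := ⟨carrier⟩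

attribute [instance] normedAddCommGroup normedSpace completeSpace smul cstarModule

/-- The `A`-valued inner product of a right Hilbert `A`-module, conjugate linear in the first
variable. -/
def ip {X : HilbertModule.{u} A} (x y : X) : A := unop (inner Aᵐᵒᵖ x y)

section
variable {X : HilbertModule.{u} A}

lemma ip_add_right (x y z : X) : ip x (y + z) = ip x y + ip x z := by simp [ip]
lemma ip_add_left (x y z : X) : ip (x + y) z = ip x z + ip y z := by simp [ip]
lemma ip_sub_right (x y z : X) : ip x (y - z) = ip x y - ip x z := by simp [ip]
lemma ip_sub_left (x y z : X) : ip (x - y) z = ip x z - ip y z := by simp [ip]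
lemma ip_smul_right (c : ℂ) (x y : X) : ip x (c • y) = c • ip x y := by simp [ip]
lemma ip_smul_left (c : ℂ) (x y : X) : ip (c • x) y = star c • ip x y := by simp [ip]
lemma star_ip (x y : X) : star (ip x y) = ip y x := by
  rw [ip, ip, ← unop_star, CStarModule.star_inner]
lemma ip_act_right (x y : X) (a : A) : ip x (op a • y) = ip x y * a := by simp [ip]
lemma ip_act_left (x y : X) (a : A) : ip (op a • x) y = star a * ip x y := by simp [ip]
lemma ip_self_nonneg (x : X) : 0 ≤ ip x x :=
  (CStarModule.inner_self_nonneg (A := Aᵐᵒᵖ) (x := x) :)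
lemma ip_self_eq_zero {x : X} : ip x x = 0 ↔ x = 0 := by
  simp [ip, CStarModule.inner_self]
lemma norm_eq (x : X) : ‖x‖ = √‖ip x x‖ := by
  rw [CStarModule.norm_eq_sqrt_norm_inner_self (A := Aᵐᵒᵖ)]; rfl
lemma norm_ip_le (x y : X) : ‖ip x y‖ ≤ ‖x‖ * ‖y‖ :=
  CStarModule.norm_inner_le (A := Aᵐᵒᵖ) X
lemma continuous_ip : Continuous fun p : X × X => ip p.1 p.2 :=
  continuous_unop.comp (CStarModule.continuous_inner (A := Aᵐᵒᵖ))
lemma ip_sum_right {ι : Type*} (s : Finset ι) (x : X) (f : ι → X) :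
    ip x (∑ i ∈ s, f i) = ∑ i ∈ s, ip x (f i) := by
  simp [ip]
lemma ip_sum_left {ι : Type*} (s : Finset ι) (x : X) (f : ι → X) :
    ip (∑ i ∈ s, f i) x = ∑ i ∈ s, ip (f i) x := by
  simp [ip]

end

/-- Build a Hilbert module from an `A`-valued inner product. -/
def ofIp (E : Type u) [NormedAddCommGroup E] [NormedSpace ℂ E] [CompleteSpace E]
    (f : E → E → A) (act : A → E → E)
    (add_right : ∀ x y z, f x (y + z) = f x y + f x z)
    (smul_right : ∀ (c : ℂ) x y, f x (c • y) = c • f x y)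
    (star_f : ∀ x y, star (f x y) = f y x)
    (act_right : ∀ x y a, f x (act a y) = f x y * a)
    (nonneg : ∀ x, 0 ≤ f x x)
    (norm_eq : ∀ x, ‖x‖ = √‖f x x‖) : HilbertModule.{u} A :=
  letI : SMul Aᵐᵒᵖ E := ⟨fun a x => act (unop a) x⟩
  letI : CStarModule Aᵐᵒᵖ E :=
    { inner := fun x y => op (f x y)
      inner_add_right := fun {x y z} => by
        rw [add_right, op_add]
      inner_self_nonneg := fun {x} => (nonneg x :)
      inner_self := fun {x} => by
        rw [op_eq_zero_iff, ← norm_eq_zero (a := x), norm_eq, Real.sqrt_eq_zero (norm_nonneg _),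
          norm_eq_zero]
      inner_op_smul_right := fun {a x y} => by
        change op (f x (act (unop a) y)) = a * op (f x y)
        rw [act_right]; rfl
      inner_smul_right_complex := fun {c x y} => by
        rw [smul_right]; rfl
      star_inner := fun x y => by
        rw [← op_star, star_f]
      norm_eq_sqrt_norm_inner_self := fun x => norm_eq x }
  { carrier := E }

end HilbertModule

open HilbertModule

/-! ### Maps between Hilbert modules -/

section maps

variable {A : Type v} [NonUnitalCStarAlgebra A] [PartialOrder A] [StarOrderedRing A]

/-- Inner-product preserving maps. Such maps are automatically `A`-linear (`IPMap.map_act`). -/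
structure IPMap (X : HilbertModule.{u} A) (Y : HilbertModule.{w} A) extends X →ₗ[ℂ] Y where
  ip_map' : ∀ x y, ip (toFun x) (toFun y) = ip x y

namespace IPMap

variable {X : HilbertModule.{u} A} {Y : HilbertModule.{w} A} {Z : HilbertModule.{w} A}

instance : CoeFun (IPMap X Y) (fun _ => X → Y) := ⟨fun f => f.toLinearMap⟩

lemma ip_map (f : IPMap X Y) (x y : X) : ip (f x) (f y) = ip x y := f.ip_map' x y

lemma norm_map (f : IPMap X Y) (x : X) : ‖f x‖ = ‖x‖ := by
  rw [norm_eq, norm_eq, ip_map]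

lemma isometry (f : IPMap X Y) : Isometry f :=
  AddMonoidHomClass.isometry_of_norm f.toLinearMap f.norm_map

lemma map_act (f : IPMap X Y) (a : A) (x : X) : f (op a • x) = op a • f x := by
  rw [← sub_eq_zero, ← ip_self_eq_zero]
  simp only [ip_sub_left, ip_sub_right, ip_act_left, ip_act_right, ip_map]
  simp [mul_assoc]

/-- The identity map. -/
def id (X : HilbertModule.{u} A) : IPMap X X := ⟨LinearMap.id, fun _ _ => rfl⟩

/-- Composition. -/
def comp (g : IPMap Y Z) (f : IPMap X Y) : IPMap X Z :=
  ⟨g.toLinearMap ∘ₗ f.toLinearMap, fun x y => (g.ip_map _ _).trans (f.ip_map x y)⟩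

/-- `f` has an adjoint. -/
def IsAdjointable (f : IPMap X Y) : Prop :=
  ∃ g : Y → X, ∀ x y, ip (f x) y = ip x (g y)

end IPMap

/-- Isomorphisms of Hilbert modules: inner-product preserving bijections (which are
automatically `A`-linear). -/
structure HilbertIso (X : HilbertModule.{u} A) (Y : HilbertModule.{w} A) extends IPMap X Y where
  surjective' : Function.Surjective toFun

instance {X : HilbertModule.{u} A} {Y : HilbertModule.{w} A} :
    CoeFun (HilbertIso X Y) (fun _ => X → Y) := ⟨fun f => f.toLinearMap⟩

end maps

/-! ### Closed submodules -/

section submodules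

variable {A : Type v} [NonUnitalCStarAlgebra A] [PartialOrder A] [StarOrderedRing A]

/-- Closed `A`-submodules of a Hilbert module. -/
structure HilbertSubmodule (X : HilbertModule.{u} A) extends Submodule ℂ X where
  isClosed' : IsClosed carrier
  act_mem' : ∀ (a : A) {x : X}, x ∈ carrier → op a • x ∈ carrier

namespace HilbertSubmodule

variable {X : HilbertModule.{u} A}

instance : Membership X (HilbertSubmodule X) := ⟨fun V x => x ∈ V.toSubmodule⟩

/-- A closed submodule is a Hilbert module with the restricted operations. -/
def toModule (V : HilbertSubmodule X) : HilbertModule.{u} A :=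
  haveI : CompleteSpace V.toSubmodule := V.isClosed'.completeSpace_coe
  ofIp V.toSubmodule (fun x y => ip (x : X) (y : X)) (fun a x => ⟨op a • (x : X), V.act_mem' a x.2⟩)
    (fun _ _ _ => ip_add_right _ _ _) (fun _ _ _ => ip_smul_right _ _ _) (fun _ _ => star_ip _ _)
    (fun _ _ _ => ip_act_right _ _ _) (fun _ => ip_self_nonneg _) (fun x => norm_eq (x : X))

/-- The inclusion of a closed submodule. -/
def incl (V : HilbertSubmodule X) : IPMap V.toModule X :=
  ⟨V.toSubmodule.subtype, fun _ _ => rfl⟩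

/-- The range of an inner-product preserving map. -/
def range {Y : HilbertModule.{w} A} (f : IPMap Y X) : HilbertSubmodule X where
  toSubmodule := f.toLinearMap.range
  isClosed' := by
    have := f.isometry.isClosedEmbedding.isClosed_range
    rwa [← LinearMap.coe_range] at this
  act_mem' := by
    rintro a _ ⟨y, rfl⟩
    exact ⟨op a • y, f.map_act a y⟩

/-- `W ⊖ V`: the elements of `W` orthogonal to `V`. -/
def ominus (W V : HilbertSubmodule X) : HilbertSubmodule X where
  carrier := {x | x ∈ W ∧ ∀ y ∈ V, ip y x = 0}
  add_mem' := fun hx hy => ⟨W.toSubmodule.add_mem hx.1 hy.1, fun z hz => by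
    rw [ip_add_right, hx.2 z hz, hy.2 z hz, add_zero]⟩
  zero_mem' := ⟨W.toSubmodule.zero_mem, fun z _ => by
    simpa using ip_smul_right 0 z (0 : X)⟩
  smul_mem' := fun c x hx => ⟨W.toSubmodule.smul_mem c hx.1, fun z hz => by
    rw [ip_smul_right, hx.2 z hz, smul_zero]⟩
  isClosed' := by
    have h : {x | x ∈ W ∧ ∀ y ∈ V, ip y x = 0} =
        (W.toSubmodule : Set X) ∩ ⋂ y ∈ {y | y ∈ V}, {x | ip y x = 0} := by
      ext x
      simp only [Set.mem_inter_iff, Set.mem_iInter, Set.mem_ofPred_eq]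
      rfl
    change IsClosed {x | x ∈ W ∧ ∀ y ∈ V, ip y x = 0}
    rw [h]
    refine W.isClosed'.inter (isClosed_biInter fun y _ => ?_)
    exact isClosed_eq (continuous_ip.comp (by fun_prop : Continuous fun x : X => (y, x)))
      continuous_const
  act_mem' := fun a x hx => ⟨W.act_mem' a hx.1, fun z hz => by
    rw [ip_act_right, hx.2 z hz, zero_mul]⟩

end HilbertSubmodule

end submodules

/-! ### Completion of a pre-Hilbert module -/

section completion

variable {A : Type v} [NonUnitalCStarAlgebra A] [PartialOrder A] [StarOrderedRing A]

/-- An `A`-valued positive semidefinite inner product on a complex vector space with a right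
action of `A`. -/
structure PreHilbert (A : Type v) [NonUnitalCStarAlgebra A] [PartialOrder A] [StarOrderedRing A]
    (E : Type u) [AddCommGroup E] [Module ℂ E] where
  ip : E → E → A
  act : A → E →ₗ[ℂ] E
  ip_add_right : ∀ x y z, ip x (y + z) = ip x y + ip x z
  ip_smul_right : ∀ (c : ℂ) x y, ip x (c • y) = c • ip x y
  star_ip : ∀ x y, star (ip x y) = ip y x
  ip_act_right : ∀ x y a, ip x (act a y) = ip x y * a
  ip_self_nonneg : ∀ x, 0 ≤ ip x x

namespace PreHilbert

variable {E : Type u} [AddCommGroup E] [Module ℂ E] (P : PreHilbert A E)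

lemma ip_add_left (x y z : E) : P.ip (x + y) z = P.ip x z + P.ip y z := by
  rw [← P.star_ip, P.ip_add_right, star_add, P.star_ip, P.star_ip]

lemma ip_smul_left (c : ℂ) (x y : E) : P.ip (c • x) y = star c • P.ip x y := by
  rw [← P.star_ip, P.ip_smul_right, star_smul, P.star_ip]

lemma ip_act_left (x y : E) (a : A) : P.ip (P.act a x) y = star a * P.ip x y := by
  rw [← P.star_ip, P.ip_act_right, star_mul, P.star_ip]

lemma isSelfAdjoint_ip (x : E) : IsSelfAdjoint (P.ip x x) := P.star_ip x x

/-- The Cauchy-Schwarz inequality. -/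
lemma norm_ip_sq_le (x y : E) : ‖P.ip x y‖ ^ 2 ≤ ‖P.ip x x‖ * ‖P.ip y y‖ := by
  have key : ∀ n : ℝ, ‖P.ip x x‖ < n → ‖P.ip x y‖ ^ 2 ≤ n * ‖P.ip y y‖ := by
    intro n hn
    have hn0 : 0 < n := (norm_nonneg _).trans_lt hn
    set a := P.ip x y with ha
    have hyx : P.ip y x = star a := by rw [ha, P.star_ip]
    have h := P.ip_self_nonneg (P.act a x + (-(n : ℂ)) • y)
    simp only [P.ip_add_left, P.ip_add_right, P.ip_smul_left, P.ip_smul_right, P.ip_act_left,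
      P.ip_act_right, hyx, ← ha] at h
    have h1 : star a * P.ip x x * a ≤ n • (star a * a) :=
      (CStarAlgebra.star_left_conjugate_le_norm_smul (hb := P.isSelfAdjoint_ip x)).trans
        (smul_le_smul_of_nonneg_right hn.le (star_mul_self_nonneg a))
    have h2 : (0 : A) ≤ n • (n • P.ip y y - star a * a) := by
      have e : ∀ b : A, (n : ℂ) • b = n • b := fun b => Complex.coe_smul n b
      have : (0 : A) ≤ n • (star a * a) + (n • (n • P.ip y y) - (2 : ℝ) • n • (star a * a)) := by
        refine h.trans ?_
        refine le_trans (le_of_eq ?_) (add_le_add_left h1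
          (n • (n • P.ip y y) - (2 : ℝ) • n • (star a * a)))
        simp only [star_neg, neg_smul, Complex.star_def, Complex.conj_ofReal, e, smul_neg, neg_neg,
          mul_assoc, two_smul]
        abel
      refine this.trans (le_of_eq ?_)
      rw [smul_sub, two_smul]; abel
    have h3 : star a * a ≤ n • P.ip y y := by
      rw [← sub_nonneg]
      have := smul_nonneg (inv_nonneg.mpr hn0.le) h2
      rwa [smul_smul, inv_mul_cancel₀ hn0.ne', one_smul] at this
    have h4 := CStarAlgebra.norm_le_norm_of_nonneg_of_le (star_mul_self_nonneg a) h3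
    rw [CStarRing.norm_star_mul_self, norm_smul, Real.norm_of_nonneg hn0.le] at h4
    rwa [sq]
  refine le_of_forall_pos_le_add fun ε hε => ?_
  have hd : 0 < ε / (‖P.ip y y‖ + 1) := by positivity
  refine (key (‖P.ip x x‖ + ε / (‖P.ip y y‖ + 1)) (by linarith)).trans ?_
  rw [add_mul]
  gcongr
  rw [div_mul_eq_mul_div, div_le_iff₀ (by positivity)]
  nlinarith [norm_nonneg (P.ip y y)]

lemma norm_ip_le (x y : E) : ‖P.ip x y‖ ≤ √‖P.ip x x‖ * √‖P.ip y y‖ := by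
  rw [← Real.sqrt_mul (norm_nonneg _)]
  exact Real.le_sqrt_of_sq_le (P.norm_ip_sq_le x y)

lemma triangle (x y : E) :
    √‖P.ip (x + y) (x + y)‖ ≤ √‖P.ip x x‖ + √‖P.ip y y‖ := by
  rw [Real.sqrt_le_left (by positivity)]
  simp only [P.ip_add_left, P.ip_add_right]
  calc ‖P.ip x x + P.ip x y + (P.ip y x + P.ip y y)‖
      ≤ ‖P.ip x x‖ + ‖P.ip x y‖ + (‖P.ip y x‖ + ‖P.ip y y‖) :=
        (norm_add_le _ _).trans (add_le_add (norm_add_le _ _) (norm_add_le _ _))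
    _ ≤ ‖P.ip x x‖ + √‖P.ip x x‖ * √‖P.ip y y‖ + (√‖P.ip y y‖ * √‖P.ip x x‖ + ‖P.ip y y‖) := by
        gcongr <;> exact P.norm_ip_le _ _
    _ = (√‖P.ip x x‖ + √‖P.ip y y‖) ^ 2 := by
        rw [add_sq, Real.sq_sqrt (norm_nonneg _), Real.sq_sqrt (norm_nonneg _)]; ring

/-- The space `E` with the seminorm `‖x‖ = ‖⟨x, x⟩‖ ^ (1/2)`. -/
def Space (_ : PreHilbert A E) : Type u := E

instance : AddCommGroup P.Space := inferInstanceAs (AddCommGroup E)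
instance : Module ℂ P.Space := inferInstanceAs (Module ℂ E)

instance : Norm P.Space := ⟨fun x => √‖P.ip x x‖⟩

lemma norm_def (x : P.Space) : ‖x‖ = √‖P.ip x x‖ := rfl

lemma core : SeminormedSpace.Core ℂ P.Space where
  norm_nonneg _ := Real.sqrt_nonneg _
  norm_smul c x := by
    rw [norm_def, norm_def]
    have : ∀ y : E, P.ip (c • y) (c • y) = star c • c • P.ip y y := fun y => by
      rw [P.ip_smul_left, P.ip_smul_right]
    refine (congrArg (fun t => √‖t‖) (this x)).trans ?_
    rw [norm_smul, norm_smul, norm_star, ← mul_assoc, Real.sqrt_mul (by positivity),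
      Real.sqrt_mul_self (norm_nonneg _)]
  norm_triangle x y := P.triangle x y

instance : SeminormedAddCommGroup P.Space := SeminormedAddCommGroup.ofCore P.core
instance : NormedSpace ℂ P.Space := ⟨fun c x => (P.core.norm_smul c x).le⟩

instance : SMul Aᵐᵒᵖ P.Space := ⟨fun a x => P.act (unop a) x⟩
instance : Inner Aᵐᵒᵖ P.Space := ⟨fun x y => op (P.ip x y)⟩

lemma norm_act_le (a : A) (x : E) : √‖P.ip (P.act a x) (P.act a x)‖ ≤ ‖a‖ * √‖P.ip x x‖ := by
  rw [P.ip_act_left, P.ip_act_right, Real.sqrt_le_left (by positivity),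
    mul_pow, Real.sq_sqrt (norm_nonneg _)]
  calc ‖star a * (P.ip x x * a)‖ ≤ ‖star a‖ * (‖P.ip x x‖ * ‖a‖) :=
        (norm_mul_le _ _).trans (by gcongr; exact norm_mul_le _ _)
    _ = ‖a‖ ^ 2 * ‖P.ip x x‖ := by rw [norm_star]; ring

instance : UniformContinuousConstSMul Aᵐᵒᵖ P.Space where
  uniformContinuous_const_smul a :=
    (LinearMap.mkContinuous (E := P.Space) (F := P.Space) (P.act (unop a)) ‖unop a‖
      (P.norm_act_le (unop a))).uniformContinuous

/-- The inner product as a bounded sesquilinear map. -/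
def ipL : P.Space →L⋆[ℂ] P.Space →L[ℂ] Aᵐᵒᵖ :=
  LinearMap.mkContinuous₂ (LinearMap.mk₂'ₛₗ (starRingEnd ℂ) (RingHom.id ℂ)
    (fun x y : P.Space => op (P.ip x y))
    (fun x y z => congrArg op (P.ip_add_left x y z)) (fun c x y => congrArg op (P.ip_smul_left c x y))
    (fun x y z => congrArg op (P.ip_add_right x y z))
    (fun c x y => congrArg op (P.ip_smul_right c x y))) 1
    (fun x y => by rw [one_mul]; exact P.norm_ip_le x y)

lemma continuous_inner : Continuous fun p : P.Space × P.Space => inner Aᵐᵒᵖ p.1 p.2 :=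
  (by fun_prop : Continuous fun p : P.Space × P.Space => P.ipL p.1 p.2)

lemma inner_coe (x y : P.Space) :
    inner Aᵐᵒᵖ (x : Completion P.Space) (y : Completion P.Space) = inner Aᵐᵒᵖ x y :=
  (Completion.isDenseInducing_coe.prodMap Completion.isDenseInducing_coe).extend_eq
    P.continuous_inner (x, y)

lemma continuous_inner_completion :
    Continuous fun p : Completion P.Space × Completion P.Space => inner Aᵐᵒᵖ p.1 p.2 := by
  let f : P.Space →+ P.Space →+ Aᵐᵒᵖ :=
    { toFun := fun x => ((P.ipL x : P.Space →ₗ[ℂ] Aᵐᵒᵖ)).toAddMonoidHom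
      map_zero' := by ext x; simp
      map_add' := fun x y => by ext z; simp }
  have : Continuous fun p : P.Space × P.Space => f p.1 p.2 := P.continuous_inner
  exact (Completion.isDenseInducing_toCompl P.Space).extend_Z_bilin
    (Completion.isDenseInducing_toCompl P.Space) this

instance : CStarModule Aᵐᵒᵖ (Completion P.Space) where
  inner_add_right {x y z} :=
    Completion.induction_on₃ x y z (by
      have := P.continuous_inner_completion
      exact isClosed_eq (this.comp (by fun_prop : Continuous fun p : Completion P.Space ×
          Completion P.Space × Completion P.Space => (p.1, p.2.1 + p.2.2)))
        ((this.comp (by fun_prop : Continuous fun p : Completion P.Space ×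
          Completion P.Space × Completion P.Space => (p.1, p.2.1))).add
        (this.comp (by fun_prop : Continuous fun p : Completion P.Space ×
          Completion P.Space × Completion P.Space => (p.1, p.2.2))))) fun a b c => by
      rw [← Completion.coe_add, inner_coe, inner_coe, inner_coe]
      exact congrArg op (P.ip_add_right a b c)
  inner_self_nonneg {x} := by
    refine Completion.induction_on x ?_ fun a => ?_
    · have := P.continuous_inner_completion.comp (continuous_id.prodMk continuous_id)
      exact (CStarAlgebra.isClosed_nonneg (A := Aᵐᵒᵖ)).preimage this
    · rw [inner_coe]; exact P.ip_self_nonneg a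
  inner_self {x} := by
    have h : ‖x‖ = √‖inner Aᵐᵒᵖ x x‖ := by
      refine Completion.induction_on x ?_ fun a => ?_
      · have := P.continuous_inner_completion.comp (continuous_id.prodMk continuous_id)
        exact isClosed_eq continuous_norm (Real.continuous_sqrt.comp this.norm)
      · rw [inner_coe, Completion.norm_coe]; rfl
    rw [← norm_eq_zero (a := x), h, Real.sqrt_eq_zero (norm_nonneg _), norm_eq_zero]
  inner_op_smul_right {a x y} :=
    Completion.induction_on₂ x y (by
      have := P.continuous_inner_completion
      have h : Continuous fun z : Completion P.Space => a • z := continuous_const_smul a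
      exact isClosed_eq (this.comp (continuous_fst.prodMk (h.comp continuous_snd)))
        (this.const_mul a)) fun b c => by
      rw [← Completion.coe_smul, inner_coe, inner_coe]
      exact congrArg op (P.ip_act_right b c (unop a))
  inner_smul_right_complex {c x y} :=
    Completion.induction_on₂ x y (by
      have := P.continuous_inner_completion
      exact isClosed_eq (this.comp (continuous_fst.prodMk (continuous_snd.const_smul c)))
        (this.const_smul c)) fun a b => by
      rw [← Completion.coe_smul, inner_coe, inner_coe]
      exact congrArg op (P.ip_smul_right c a b)
  star_inner x y :=
    Completion.induction_on₂ x y (by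
      have := P.continuous_inner_completion
      exact isClosed_eq this.star (this.comp continuous_swap)) fun a b => by
      rw [inner_coe, inner_coe]
      exact congrArg op (P.star_ip a b)
  norm_eq_sqrt_norm_inner_self x := by
    refine Completion.induction_on x ?_ fun a => ?_
    · have := P.continuous_inner_completion.comp (continuous_id.prodMk continuous_id)
      exact isClosed_eq continuous_norm (Real.continuous_sqrt.comp this.norm)
    · rw [inner_coe, Completion.norm_coe]; rfl

/-- The Hilbert module obtained by completing (and dividing out the vectors of length zero). -/
def completion : HilbertModule.{u} A := { carrier := Completion P.Space }

/-- The canonical map of a pre-Hilbert module into its completion. -/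
def toCompletion : E →ₗ[ℂ] P.completion :=
  (Completion.toComplₗᵢ (𝕜 := ℂ) (E := P.Space)).toLinearMap

lemma ip_toCompletion (x y : E) : HilbertModule.ip (P.toCompletion x) (P.toCompletion y) = P.ip x y :=
  congrArg unop (P.inner_coe x y)

lemma denseRange_toCompletion : DenseRange P.toCompletion :=
  Completion.denseRange_coe (α := P.Space)

lemma norm_toCompletion (x : E) : ‖P.toCompletion x‖ = √‖P.ip x x‖ := by
  rw [HilbertModule.norm_eq, ip_toCompletion]

/-- An inner-product preserving linear map of a pre-Hilbert module into a Hilbert module extends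
to the completion. -/
def extend {Z : HilbertModule.{w} A} (f : E →ₗ[ℂ] Z)
    (hf : ∀ x y, HilbertModule.ip (f x) (f y) = P.ip x y) : IPMap P.completion Z :=
  { toLinearMap := (f.extendOfNorm P.toCompletion).toLinearMap
    ip_map' := fun x y => by
      have h : ∃ C, ∀ x, ‖f x‖ ≤ C * ‖P.toCompletion x‖ :=
        ⟨1, fun x => by rw [one_mul, norm_toCompletion, HilbertModule.norm_eq, hf]⟩
      have hc := (f.extendOfNorm P.toCompletion).continuous
      change HilbertModule.ip (f.extendOfNorm P.toCompletion x)
        (f.extendOfNorm P.toCompletion y) = _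
      refine P.denseRange_toCompletion.induction_on₂ (p := fun x y =>
        HilbertModule.ip (f.extendOfNorm P.toCompletion x)
          (f.extendOfNorm P.toCompletion y) = HilbertModule.ip x y)
        (isClosed_eq (continuous_ip.comp (hc.prodMap hc)) continuous_ip) (fun a b => ?_) x y
      rw [LinearMap.extendOfNorm_eq P.denseRange_toCompletion h,
        LinearMap.extendOfNorm_eq P.denseRange_toCompletion h, hf, ip_toCompletion] }

lemma extend_toCompletion {Z : HilbertModule.{w} A} (f : E →ₗ[ℂ] Z)
    (hf : ∀ x y, HilbertModule.ip (f x) (f y) = P.ip x y) (x : E) :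
    P.extend f hf (P.toCompletion x) = f x :=
  LinearMap.extendOfNorm_eq P.denseRange_toCompletion
    ⟨1, fun x => by rw [one_mul, norm_toCompletion, HilbertModule.norm_eq, hf]⟩ x

end PreHilbert

end completion

/-! ### Correspondences and internal tensor products -/

section tensor

variable {A : Type v} [NonUnitalCStarAlgebra A] [PartialOrder A] [StarOrderedRing A]

/-- A correspondence over `A`: a right Hilbert `A`-module with a left action of `A` by adjointable
operators, given by a `*`-homomorphism. -/
structure Correspondence (A : Type v) [NonUnitalCStarAlgebra A] [PartialOrder A]
    [StarOrderedRing A] extends HilbertModule.{u} A where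
  lact : A →ₙₐ[ℂ] (carrier →L[ℂ] carrier)
  lact_star : ∀ (a : A) (m n : toHilbertModule), ip (lact a m) n = ip m (lact (star a) n)

lemma exists_posPart_negPart {B : Type*} [NonUnitalCStarAlgebra B] [PartialOrder B]
    [StarOrderedRing B] {b : B} (hb : IsSelfAdjoint b) :
    ∃ p n : B, 0 ≤ p ∧ 0 ≤ n ∧ n * p = 0 ∧ b = p - n :=
  ⟨b⁺, b⁻, CFC.posPart_nonneg b, CFC.negPart_nonneg b, CFC.negPart_mul_posPart b,
    (CFC.posPart_sub_negPart b hb).symm⟩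

lemma exists_eq_star_mul_self {B : Type*} [NonUnitalCStarAlgebra B] [PartialOrder B]
    [StarOrderedRing B] {b : B} (hb : 0 ≤ b) : ∃ c : B, b = star c * c :=
  CStarAlgebra.nonneg_iff_eq_star_mul_self.mp hb

/-- A Gram matrix is of the form `B* B`. -/
lemma exists_gram_eq {X : HilbertModule.{u} A} {ι : Type*} [Fintype ι] (x : ι → X) :
    ∃ B : ι → ι → A, ∀ i j, ip (x i) (x j) = ∑ k, star (B k i) * B k j := by
  classical
  let G : CStarMatrix ι ι A := CStarMatrix.ofMatrix fun i j => ip (x i) (x j)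
  have hG : IsSelfAdjoint G := by
    ext i j
    exact star_ip (x j) (x i)
  obtain ⟨P, N, hP0, hN0, hNP, hGPN⟩ := exists_posPart_negPart hG
  have hN : star N = N := IsSelfAdjoint.of_nonneg hN0
  obtain ⟨C, hC⟩ := exists_eq_star_mul_self hN0
  have h1 : N * G * N + star (C * N) * (C * N) = 0 := by
    have e1 : N * G * N = -(N * N * N) := by
      rw [hGPN, mul_sub, hNP, zero_sub, neg_mul]
    have e2 : star (C * N) * (C * N) = N * N * N := by
      rw [star_mul, hN, mul_assoc, ← mul_assoc (star C), ← hC, mul_assoc]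
    rw [e1, e2, neg_add_cancel]
  set D := C * N with hD
  have h2 : ∀ k, ∑ l, star (D l k) * D l k = 0 := by
    intro k
    have h3 : (N * G * N) k k = ip (∑ i, op (N i k) • x i) (∑ i, op (N i k) • x i) := by
      have hs : ∀ i, N k i = star (N i k) := fun i => by
        conv_lhs => rw [← hN]
        rfl
      simp only [CStarMatrix.mul_apply, ip_sum_left, ip_sum_right, ip_act_left, ip_act_right,
        Finset.sum_mul, hs, mul_assoc]
      rfl
    have h4 : (N * G * N) k k + ∑ l, star (D l k) * D l k = 0 := by
      have := congrArg (fun Q : CStarMatrix ι ι A => Q k k) h1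
      exact this
    have h5 : 0 ≤ ∑ l, star (D l k) * D l k := Finset.sum_nonneg fun l _ => star_mul_self_nonneg _
    have h6 : 0 ≤ (N * G * N) k k := by rw [h3]; exact ip_self_nonneg _
    refine le_antisymm ?_ h5
    rw [← h4]; exact le_add_of_nonneg_left h6
  have h7 : D = 0 := by
    ext l k
    have := (Finset.sum_eq_zero_iff_of_nonneg
      (fun l _ => star_mul_self_nonneg (D l k))).mp (h2 k) l (Finset.mem_univ l)
    exact (CStarRing.star_mul_self_eq_zero_iff _).mp this
  have h8 : N = 0 := by
    have a1 : star (N * N) * (N * N) = 0 := by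
      have : N * N = star C * D := by rw [hD, ← mul_assoc, ← hC]
      rw [this, h7]; simp
    have a2 := (CStarRing.star_mul_self_eq_zero_iff _).mp a1
    refine (CStarRing.star_mul_self_eq_zero_iff _).mp ?_
    rw [hN]; exact a2
  obtain ⟨B, hB⟩ := exists_eq_star_mul_self hP0
  refine ⟨fun k i => B k i, fun i j => ?_⟩
  have : G i j = (star B * B) i j := by rw [hGPN, h8, sub_zero, ← hB]
  exact this

namespace Correspondence

variable (X : HilbertModule.{u} A) (M : Correspondence.{w} A)

lemma ip_lact (a : A) (m n : M.toHilbertModule) :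
    ip m (M.lact a n) = ip (M.lact (star a) m) n := by
  rw [M.lact_star, star_star]

/-- The inner product `⟨x ⊗ m, y ⊗ n⟩ = ⟨m, ⟨x, y⟩ · n⟩` on the algebraic tensor product. -/
def tensorForm : (X ⊗[ℂ] M.toHilbertModule) →ₗ⋆[ℂ] (X ⊗[ℂ] M.toHilbertModule) →ₗ[ℂ] A :=
  TensorProduct.lift (LinearMap.mk₂'ₛₗ (starRingEnd ℂ) (starRingEnd ℂ)
    (fun (x : X) (m : M.toHilbertModule) => TensorProduct.lift (LinearMap.mk₂ ℂ
      (fun (y : X) (n : M.toHilbertModule) => ip m (M.lact (ip x y) n))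
      (fun y y' n => by simp [ip_add_right])
      (fun c y n => by simp [ip_smul_right])
      (fun y n n' => by simp [ip_add_right])
      (fun c y n => by simp [ip_smul_right])))
    (fun x x' m => by
      ext y n; simp [ip_add_right, ip_add_left])
    (fun c x m => by
      ext y n; simp [ip_smul_right, ip_smul_left])
    (fun x m m' => by
      ext y n; simp [ip_add_left])
    (fun c x m => by
      ext y n; simp [ip_smul_left]))

lemma tensorForm_tmul (x y : X) (m n : M.toHilbertModule) :
    tensorForm X M (x ⊗ₜ m) (y ⊗ₜ n) = ip m (M.lact (ip x y) n) := rfl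

/-- The right action of `a : A` on a Hilbert module, as a linear map. -/
def actₗ (X : HilbertModule.{u} A) (a : A) : X →ₗ[ℂ] X where
  toFun x := op a • x
  map_add' x y := by
    rw [← sub_eq_zero, ← ip_self_eq_zero]
    simp only [ip_sub_left, ip_sub_right, ip_add_left, ip_add_right, ip_act_left, ip_act_right,
      mul_add, add_mul]
    abel
  map_smul' c x := by
    rw [← sub_eq_zero, ← ip_self_eq_zero]
    simp only [ip_sub_left, ip_sub_right, ip_smul_left, ip_smul_right, ip_act_left, ip_act_right,
      RingHom.id_apply, smul_mul_assoc, mul_smul_comm]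
    abel

/-- The algebraic tensor product as a pre-Hilbert module. -/
def preTensor : PreHilbert A (X ⊗[ℂ] M.toHilbertModule) where
  ip s t := tensorForm X M s t
  act a := TensorProduct.map LinearMap.id (actₗ M.toHilbertModule a)
  ip_add_right s t t' := map_add _ _ _
  ip_smul_right c s t := map_smul _ _ _
  star_ip s t := by
    induction s with
    | zero => simp
    | add s s' hs hs' => simp [hs, hs']
    | tmul x m =>
      induction t with
      | zero => simp
      | add s s' hs hs' => simp [hs, hs']
      | tmul y n =>
        rw [tensorForm_tmul, tensorForm_tmul, HilbertModule.star_ip, M.lact_star,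
          HilbertModule.star_ip]
  ip_act_right s t a := by
    induction s with
    | zero => simp
    | add s s' hs hs' => simp [hs, hs', add_mul]
    | tmul x m =>
      induction t with
      | zero => simp
      | add s s' hs hs' => simp only [map_add, hs, hs', add_mul]
      | tmul y n =>
        rw [TensorProduct.map_tmul, LinearMap.id_apply, tensorForm_tmul, tensorForm_tmul,
          ip_lact, ip_lact]
        exact ip_act_right _ _ _
  ip_self_nonneg t := by
    obtain ⟨S, rfl⟩ := TensorProduct.exists_finset t
    obtain ⟨B, hB⟩ := exists_gram_eq (fun i : S => i.1.1)
    have : tensorForm X M (∑ i ∈ S, i.1 ⊗ₜ i.2) (∑ i ∈ S, i.1 ⊗ₜ i.2) =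
        ∑ k : S, ip (∑ i : S, M.lact (B k i) i.1.2) (∑ i : S, M.lact (B k i) i.1.2) := by
      rw [← Finset.sum_coe_sort S]
      simp only [map_sum, LinearMap.sum_apply, tensorForm_tmul, hB, ip_sum_left, ip_sum_right,
        M.lact_star, ← mul_apply_eq_comp, ← map_mul, sum_apply]
      symm
      rw [Finset.sum_comm]
      exact Finset.sum_congr rfl fun i _ => Finset.sum_comm
    rw [this]
    exact Finset.sum_nonneg fun k _ => HilbertModule.ip_self_nonneg _

end Correspondence

open Correspondence

/-- The internal tensor product `X ⊗_A M`. -/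
def HilbertModule.tensor (X : HilbertModule.{u} A) (M : Correspondence.{u} A) :
    HilbertModule.{u} A :=
  (preTensor X M).completion

/-- The elementary tensor `x ⊗ m` in `X ⊗_A M`. -/
def HilbertModule.tmul {X : HilbertModule.{u} A} {M : Correspondence.{u} A} (x : X)
    (m : M.toHilbertModule) : X.tensor M :=
  (preTensor X M).toCompletion (x ⊗ₜ m)

/-- `f ⊗ id : X ⊗_A M → X' ⊗_A M`. -/
def IPMap.tensor {X X' : HilbertModule.{u} A} (f : IPMap X X') (M : Correspondence.{u} A) :
    IPMap (X.tensor M) (X'.tensor M) :=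
  (preTensor X M).extend (Z := (preTensor X' M).completion)
    ((preTensor X' M).toCompletion ∘ₗ TensorProduct.map f.toLinearMap LinearMap.id) (fun s t => by
      rw [LinearMap.comp_apply, LinearMap.comp_apply, PreHilbert.ip_toCompletion]
      change tensorForm X' M _ _ = tensorForm X M _ _
      induction s with
      | zero => simp
      | add s s' hs hs' => simp [hs, hs']
      | tmul x m =>
        induction t with
        | zero => simp
        | add s s' hs hs' => simp only [map_add, hs, hs']
        | tmul y n =>
          rw [TensorProduct.map_tmul, TensorProduct.map_tmul, tensorForm_tmul, tensorForm_tmul]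
          exact congrArg (fun a => ip m (M.lact a n)) (f.ip_map x y))

lemma IPMap.tensor_tmul {X X' : HilbertModule.{u} A} (f : IPMap X X') (M : Correspondence.{u} A)
    (x : X) (m : M.toHilbertModule) : f.tensor M (tmul x m) = tmul (f x) m :=
  PreHilbert.extend_toCompletion _ _ _ _

/-- `X ⊗_A M^{⊗ k}`, with tensor powers bracketed from the left:
`((X ⊗_A M) ⊗_A M) ⊗_A ⋯ ⊗_A M`. -/
def HilbertModule.tensorPow (X : HilbertModule.{u} A) (M : Correspondence.{u} A) :
    ℕ → HilbertModule.{u} A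
  | 0 => X
  | k + 1 => (X.tensorPow M k).tensor M

/-- `f ⊗ id_k : X ⊗_A M^{⊗ k} → X' ⊗_A M^{⊗ k}`. -/
def IPMap.tensorPow {X X' : HilbertModule.{u} A} (f : IPMap X X') (M : Correspondence.{u} A) :
    ∀ k, IPMap (X.tensorPow M k) (X'.tensorPow M k)
  | 0 => f
  | k + 1 => (f.tensorPow M k).tensor M

/-- For `f : X → X' ⊗_A M`, the map
`f ⊗ id_k : X ⊗_A M^{⊗ k} → (X' ⊗_A M) ⊗_A M^{⊗ k} = X' ⊗_A M^{⊗ (k + 1)}`. -/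
def IPMap.tensorStep {X X' : HilbertModule.{u} A} {M : Correspondence.{u} A}
    (f : IPMap X (X'.tensor M)) : ∀ k, IPMap (X.tensorPow M k) (X'.tensorPow M (k + 1))
  | 0 => f
  | k + 1 => (f.tensorStep k).tensor M

/-- For `U : X → X ⊗_A M`, the map `U^k : X → X ⊗_A M^{⊗ k}` with `U^0 = id` and
`U^{k+1} = (U ⊗ id_k) ∘ U^k`. -/
def IPMap.iterate {X : HilbertModule.{u} A} {M : Correspondence.{u} A}
    (U : IPMap X (X.tensor M)) : ∀ k, IPMap X (X.tensorPow M k)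
  | 0 => IPMap.id X
  | k + 1 => (U.tensorStep k).comp (U.iterate k)

end tensor

/-! ### Direct limits -/

section limit

variable {A : Type v} [NonUnitalCStarAlgebra A] [PartialOrder A] [StarOrderedRing A]

namespace HilbertLimit

variable (X : ℕ → HilbertModule.{u} A) (T : ∀ k, IPMap (X k) (X (k + 1)))

/-- The algebraic direct limit is realised by the sequences `(x_k)` with `x_{k+1} = T_k x_k` for
all large `k`; two such sequences define the same element if they agree for all large `k`, and
this identification is made when vectors of length zero are divided out below. -/
def seqs : Submodule ℂ (∀ k, X k) where
  carrier := {x | ∃ N, ∀ k ≥ N, x (k + 1) = T k (x k)}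
  add_mem' := by
    rintro x y ⟨N, hN⟩ ⟨N', hN'⟩
    refine ⟨max N N', fun k hk => ?_⟩
    rw [Pi.add_apply, Pi.add_apply, map_add, hN k (le_of_max_le_left hk),
      hN' k (le_of_max_le_right hk)]
  zero_mem' := ⟨0, fun k _ => (map_zero _).symm⟩
  smul_mem' := by
    rintro c x ⟨N, hN⟩
    exact ⟨N, fun k hk => by rw [Pi.smul_apply, Pi.smul_apply, map_smul, hN k hk]⟩

/-- The eventually constant value of `⟨x_k, y_k⟩`. -/
def seqIp (x y : seqs X T) : A := Filter.atTop.limUnder fun k => ip (x.1 k) (y.1 k)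

lemma eventually_seqIp (x y : seqs X T) :
    ∀ᶠ k in Filter.atTop, seqIp X T x y = ip (x.1 k) (y.1 k) := by
  obtain ⟨N, hN⟩ := x.2
  obtain ⟨N', hN'⟩ := y.2
  have h : ∀ k ≥ max N N', ip (x.1 k) (y.1 k) =
      ip (x.1 (max N N')) (y.1 (max N N')) := by
    intro k hk
    induction k, hk using Nat.le_induction with
    | base => rfl
    | succ k hk ih =>
      rw [hN k (le_of_max_le_left hk), hN' k (le_of_max_le_right hk), IPMap.ip_map, ih]
  have h2 : seqIp X T x y = ip (x.1 (max N N')) (y.1 (max N N')) :=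
    (tendsto_const_nhds.congr' (Filter.eventually_atTop.mpr
      ⟨max N N', fun k hk => (h k hk).symm⟩)).limUnder_eq
  exact Filter.eventually_atTop.mpr ⟨max N N', fun k hk => h2.trans (h k hk).symm⟩

/-- The algebraic direct limit as a pre-Hilbert module. -/
def pre : PreHilbert A (seqs X T) where
  ip := seqIp X T
  act a :=
    { toFun := fun x => ⟨fun k => op a • x.1 k, by
        obtain ⟨N, hN⟩ := x.2
        exact ⟨N, fun k hk => by beta_reduce; rw [hN k hk, IPMap.map_act]⟩⟩
      map_add' := fun x y => Subtype.ext <| funext fun k =>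
        (Correspondence.actₗ (X k) a).map_add _ _
      map_smul' := fun c x => Subtype.ext <| funext fun k =>
        (Correspondence.actₗ (X k) a).map_smul _ _ }
  ip_add_right x y z := by
    obtain ⟨k, h1, h2, h3⟩ := ((eventually_seqIp X T x (y + z)).and
      ((eventually_seqIp X T x y).and (eventually_seqIp X T x z))).exists
    rw [h1, h2, h3]; exact ip_add_right _ _ _
  ip_smul_right c x y := by
    obtain ⟨k, h1, h2⟩ := ((eventually_seqIp X T x (c • y)).and
      (eventually_seqIp X T x y)).exists
    rw [h1, h2]; exact ip_smul_right _ _ _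
  star_ip x y := by
    obtain ⟨k, h1, h2⟩ := ((eventually_seqIp X T x y).and (eventually_seqIp X T y x)).exists
    rw [h1, h2]; exact star_ip _ _
  ip_act_right x y a := by
    obtain ⟨k, h1, h2⟩ := ((eventually_seqIp X T x _).and (eventually_seqIp X T x y)).exists
    rw [h1, h2]; exact ip_act_right _ _ _
  ip_self_nonneg x := by
    obtain ⟨k, h⟩ := (eventually_seqIp X T x x).exists
    rw [h]; exact ip_self_nonneg _

/-- The maps `T_{k-1} ∘ ⋯ ∘ T_j : X_j → X_k` for `j ≤ k`. -/
def transition {j k : ℕ} (h : j ≤ k) : IPMap (X j) (X k) :=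
  Nat.leRecOn (C := fun n => IPMap (X j) (X n)) h (fun {n} f => (T n).comp f) (IPMap.id (X j))

lemma transition_succ {j k : ℕ} (h : j ≤ k) (x : X j) :
    transition X T (Nat.le_succ_of_le h) x = T k (transition X T h x) := by
  unfold transition
  rw [Nat.leRecOn_succ h]; rfl

/-- The class of `x : X k` in the algebraic direct limit. -/
def toSeqs (k : ℕ) : X k →ₗ[ℂ] seqs X T where
  toFun x := ⟨fun j => if h : k ≤ j then transition X T h x else 0, k, fun j hj => by
    beta_reduce
    rw [dif_pos hj, dif_pos (show k ≤ j + 1 from Nat.le_succ_of_le hj), transition_succ]⟩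
  map_add' x y := by
    ext j
    by_cases h : k ≤ j <;> simp [h]
  map_smul' c x := by
    ext j
    by_cases h : k ≤ j <;> simp [h]

end HilbertLimit

/-- The direct limit of a sequence of Hilbert modules and inner-product preserving maps: the
completion of the algebraic direct limit. -/
def directLimit (X : ℕ → HilbertModule.{u} A) (T : ∀ k, IPMap (X k) (X (k + 1))) :
    HilbertModule.{u} A :=
  (HilbertLimit.pre X T).completion

/-- The canonical maps `ι^k : X_k → X_∞`. -/
def directLimit.ι (X : ℕ → HilbertModule.{u} A) (T : ∀ k, IPMap (X k) (X (k + 1))) (k : ℕ) :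
    IPMap (X k) (directLimit X T) where
  toLinearMap := (HilbertLimit.pre X T).toCompletion ∘ₗ HilbertLimit.toSeqs X T k
  ip_map' x y := by
    refine ((HilbertLimit.pre X T).ip_toCompletion _ _).trans ?_
    obtain ⟨j, h1, h2⟩ := ((HilbertLimit.eventually_seqIp X T (HilbertLimit.toSeqs X T k x)
      (HilbertLimit.toSeqs X T k y)).and (Filter.eventually_ge_atTop k)).exists
    refine h1.trans ?_
    simp only [HilbertLimit.toSeqs, LinearMap.coe_mk, AddHom.coe_mk, dif_pos h2, IPMap.ip_map]

end limit

/-! ### Direct sums -/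

section directSum

variable {A : Type v} [NonUnitalCStarAlgebra A] [PartialOrder A] [StarOrderedRing A]

/-- A complete pre-Hilbert module with a definite inner product is a Hilbert module. -/
def PreHilbert.toHilbertModule {E : Type u} [AddCommGroup E] [Module ℂ E] (P : PreHilbert A E)
    (hdef : ∀ x, P.ip x x = 0 → x = 0) (hc : CompleteSpace P.Space) : HilbertModule.{u} A :=
  letI : NormedAddCommGroup P.Space := NormedAddCommGroup.ofSeparation fun x hx =>
    hdef x (by rwa [P.norm_def, Real.sqrt_eq_zero (norm_nonneg _), norm_eq_zero] at hx)
  ofIp P.Space P.ip (fun a => P.act a) P.ip_add_right P.ip_smul_right P.star_ip P.ip_act_right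
    P.ip_self_nonneg (fun _ => rfl)

namespace HilbertSum

variable {ι : Type} (W : ι → HilbertModule.{u} A)

/-- The inner product of the components in a finite set. -/
def finPre (s : Finset ι) : PreHilbert A (∀ i, W i) where
  ip x y := ∑ i ∈ s, ip (x i) (y i)
  act a := LinearMap.pi fun i => (Correspondence.actₗ (W i) a) ∘ₗ LinearMap.proj i
  ip_add_right x y z := by simp [ip_add_right, Finset.sum_add_distrib]
  ip_smul_right c x y := by simp [ip_smul_right, Finset.smul_sum]
  star_ip x y := by simp [star_ip]
  ip_act_right x y a := by
    rw [Finset.sum_mul]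
    exact Finset.sum_congr rfl fun i _ => ip_act_right _ _ _
  ip_self_nonneg x := Finset.sum_nonneg fun i _ => ip_self_nonneg _

lemma summable_ip {x y : ∀ i, W i} (hx : Summable fun i => ip (x i) (x i))
    (hy : Summable fun i => ip (y i) (y i)) : Summable fun i => ip (x i) (y i) := by
  classical
  rw [summable_iff_vanishing_norm] at *
  intro ε hε
  obtain ⟨s, hs⟩ := hx ε hε
  obtain ⟨s', hs'⟩ := hy ε hε
  refine ⟨s ∪ s', fun t ht => ?_⟩
  rw [Finset.disjoint_union_right] at ht
  have h1 := hs t ht.1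
  have h2 := hs' t ht.2
  have h3 : ‖∑ i ∈ t, ip (x i) (y i)‖ ≤
      √‖∑ i ∈ t, ip (x i) (x i)‖ * √‖∑ i ∈ t, ip (y i) (y i)‖ := (finPre W t).norm_ip_le x y
  refine h3.trans_lt ?_
  calc √‖∑ i ∈ t, ip (x i) (x i)‖ * √‖∑ i ∈ t, ip (y i) (y i)‖ < √ε * √ε := by
        have := Real.sqrt_lt_sqrt (norm_nonneg _) h1
        have := Real.sqrt_lt_sqrt (norm_nonneg _) h2
        exact mul_lt_mul'' ‹_› ‹_› (Real.sqrt_nonneg _) (Real.sqrt_nonneg _)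
    _ = ε := Real.mul_self_sqrt hε.le

/-- The families `(x_i)` for which `∑ ⟨x_i, x_i⟩` converges in `A`. -/
def families : Submodule ℂ (∀ i, W i) where
  carrier := {x | Summable fun i => ip (x i) (x i)}
  add_mem' := fun {x y} hx hy => by
    have := ((hx.add (summable_ip W hx hy)).add (summable_ip W hy hx)).add hy
    refine this.congr fun i => ?_
    simp only [Pi.add_apply, ip_add_left, ip_add_right]
    abel
  zero_mem' := by
    refine summable_zero.congr fun i => ?_
    exact (ip_self_eq_zero.mpr rfl).symm
  smul_mem' := fun c x hx => by
    refine ((Summable.const_smul c hx).const_smul (star c)).congr fun i => ?_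
    simp only [Pi.smul_apply, ip_smul_left, ip_smul_right, smul_comm c]

/-- The inner product `⟨x, y⟩ = ∑ ⟨x_i, y_i⟩`. -/
def pre : PreHilbert A (families W) where
  ip x y := ∑' i, ip (x.1 i) (y.1 i)
  act a := ((finPre W ∅).act a ∘ₗ (families W).subtype).codRestrict (families W) fun x => by
    refine ((x.2.mul_right a).mul_left (star a)).congr fun i => ?_
    exact ((ip_act_left _ _ _).trans (congrArg _ (ip_act_right _ _ _))).symm
  ip_add_right x y z := by
    rw [← (summable_ip W x.2 y.2).tsum_add (summable_ip W x.2 z.2)]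
    exact tsum_congr fun i => ip_add_right _ _ _
  ip_smul_right c x y := by
    rw [← (summable_ip W x.2 y.2).tsum_const_smul c]
    exact tsum_congr fun i => ip_smul_right _ _ _
  star_ip x y := by
    refine (tsum_star (f := fun i => ip (x.1 i) (y.1 i))).trans ?_
    exact tsum_congr fun i => star_ip _ _
  ip_act_right x y a := by
    rw [← (summable_ip W x.2 y.2).tsum_mul_right a]
    exact tsum_congr fun i => ip_act_right _ _ _
  ip_self_nonneg x := by
    refine (CStarAlgebra.isClosed_nonneg (A := A)).mem_of_tendsto x.2.hasSum
      (Filter.Eventually.of_forall fun s => ?_)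
    exact Finset.sum_nonneg fun i _ => ip_self_nonneg _

lemma fin_norm_le (x : families W) (t : Finset ι) :
    ‖∑ i ∈ t, ip (x.1 i) (x.1 i)‖ ≤ ‖(pre W).ip x x‖ := by
  refine ge_of_tendsto x.2.hasSum.norm (Filter.eventually_atTop.mpr ⟨t, fun s hs => ?_⟩)
  exact CStarAlgebra.norm_le_norm_of_nonneg_of_le (Finset.sum_nonneg fun i _ => ip_self_nonneg _)
    (Finset.sum_le_sum_of_subset_of_nonneg hs fun i _ _ => ip_self_nonneg _)

lemma norm_apply_le (x : families W) (i : ι) : ‖x.1 i‖ ≤ √‖(pre W).ip x x‖ := by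
  rw [norm_eq]
  refine Real.sqrt_le_sqrt ?_
  simpa using fin_norm_le W x {i}

lemma definite (x : families W) (h : (pre W).ip x x = 0) : x = 0 := by
  ext i
  have := norm_apply_le W x i
  rw [h, norm_zero, Real.sqrt_zero] at this
  exact norm_le_zero_iff.mp this

lemma complete : CompleteSpace (pre W).Space := by
  classical
  refine Metric.complete_of_cauchySeq_tendsto fun u hu => ?_
  let c : ℕ → families W := u
  have hdist : ∀ m n, dist (u m) (u n) = √‖(pre W).ip (c m - c n) (c m - c n)‖ := fun m n => by
    rw [dist_eq_norm]; rfl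
  have hcomp : ∀ i, ∃ z : W i, Filter.Tendsto (fun n => (c n).1 i) Filter.atTop (nhds z) := by
    intro i
    refine cauchySeq_tendsto_of_complete ?_
    rw [Metric.cauchySeq_iff] at hu ⊢
    intro ε hε
    obtain ⟨N, hN⟩ := hu ε hε
    refine ⟨N, fun m hm n hn => lt_of_le_of_lt ?_ (hN m hm n hn)⟩
    rw [hdist, dist_eq_norm]
    exact norm_apply_le W (c m - c n) i
  choose z hz using hcomp
  have key : ∀ ε > 0, ∃ N, ∀ n ≥ N, ∀ t : Finset ι,
      √‖(finPre W t).ip (z - (c n).1) (z - (c n).1)‖ ≤ ε := by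
    intro ε hε
    obtain ⟨N, hN⟩ := Metric.cauchySeq_iff.mp hu ε hε
    refine ⟨N, fun n hn t => ?_⟩
    have hlim : Filter.Tendsto
        (fun m => √‖∑ i ∈ t, ip ((c m).1 i - (c n).1 i) ((c m).1 i - (c n).1 i)‖) Filter.atTop
        (nhds √‖∑ i ∈ t, ip (z i - (c n).1 i) (z i - (c n).1 i)‖) := by
      refine (tendsto_finsetSum t fun i _ => ?_).norm.sqrt
      have := (hz i).sub_const ((c n).1 i)
      exact (continuous_ip.tendsto _).comp (this.prodMk_nhds this)
    refine le_of_tendsto hlim (Filter.eventually_atTop.mpr ⟨N, fun m hm => ?_⟩)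
    have h1 := hN m hm n hn
    rw [hdist] at h1
    exact (Real.sqrt_le_sqrt (fin_norm_le W (c m - c n) t)).trans h1.le
  have hzmem : z ∈ families W := by
    change Summable fun i => ip (z i) (z i)
    rw [summable_iff_vanishing_norm]
    intro ε hε
    obtain ⟨N, hN⟩ := key (√ε / 3) (by positivity)
    have hs := (c N).2
    change Summable fun i => ip ((c N).1 i) ((c N).1 i) at hs
    rw [summable_iff_vanishing_norm] at hs
    obtain ⟨s, hs⟩ := hs ((√ε / 3) ^ 2) (by positivity)
    refine ⟨s, fun t ht => ?_⟩
    have h1 := hN N le_rfl t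
    have h2 : √‖(finPre W t).ip (c N).1 (c N).1‖ ≤ √ε / 3 := by
      rw [Real.sqrt_le_left (by positivity)]
      exact (hs t ht).le
    have h3 := (finPre W t).triangle (z - (c N).1) (c N).1
    rw [sub_add_cancel] at h3
    have h4 : √‖(finPre W t).ip z z‖ < √ε := by
      have : 0 < √ε := Real.sqrt_pos.mpr hε
      linarith
    exact (Real.sqrt_lt_sqrt_iff (norm_nonneg _)).mp h4
  let zz : families W := ⟨z, hzmem⟩
  refine ⟨(zz : (pre W).Space), Metric.tendsto_atTop.mpr fun ε hε => ?_⟩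
  obtain ⟨N, hN⟩ := key (ε / 2) (by positivity)
  refine ⟨N, fun n hn => ?_⟩
  have h1 : dist (u n) (zz : (pre W).Space) = √‖(pre W).ip (zz - c n) (zz - c n)‖ := by
    refine (dist_comm _ _).trans ((dist_eq_norm (E := (pre W).Space) _ _).trans rfl)
  rw [h1]
  refine lt_of_le_of_lt ?_ (half_lt_self hε)
  refine le_of_tendsto (zz - c n).2.hasSum.norm.sqrt (Filter.Eventually.of_forall fun t => ?_)
  exact hN n hn t

end HilbertSum

/-- The Hilbert-module direct sum `⨁ W_i`: all families `(x_i)` with `∑ ⟨x_i, x_i⟩` convergent in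
`A`, with the inner product `∑ ⟨x_i, y_i⟩`. -/
def hilbertSum {ι : Type} (W : ι → HilbertModule.{u} A) : HilbertModule.{u} A :=
  (HilbertSum.pre W).toHilbertModule (HilbertSum.definite W) (HilbertSum.complete W)

/-- The components of an element of the direct sum. -/
def hilbertSum.component {ι : Type} {W : ι → HilbertModule.{u} A} (x : hilbertSum W) (i : ι) :
    W i :=
  (show HilbertSum.families W from x).1 i

end directSum

/-! ### The multi-resolution analysis -/

section mra

variable {A : Type v} [NonUnitalCStarAlgebra A] [PartialOrder A] [StarOrderedRing A]
  {M : Correspondence.{u} A} {Y : HilbertModule.{u} A}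

namespace MRA

/-- `Y_∞ = lim (Y ⊗_A M^{⊗ k}, T_k)` with `T_k = T ⊗ id_k`. -/
def limit (T : IPMap Y (Y.tensor M)) : HilbertModule.{u} A :=
  directLimit (fun k => Y.tensorPow M k) T.tensorStep

/-- `ι^k : Y ⊗_A M^{⊗ k} → Y_∞`. -/
def ι (T : IPMap Y (Y.tensor M)) (k : ℕ) : IPMap (Y.tensorPow M k) (limit T) :=
  directLimit.ι (fun k => Y.tensorPow M k) T.tensorStep k

/-- `Y_k = ι^k (Y ⊗_A M^{⊗ k})`. -/
def subY (T : IPMap Y (Y.tensor M)) (k : ℕ) : HilbertSubmodule (limit T) :=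
  HilbertSubmodule.range (ι T k)

/-- `Z_k = Y_{k+1} ⊖ Y_k`. -/
def subZ (T : IPMap Y (Y.tensor M)) (k : ℕ) : HilbertSubmodule (limit T) :=
  (subY T (k + 1)).ominus (subY T k)

/-- The summands of `Y_0 ⊕ (⨁_k Z_k)`: `Y_0` at `none` and `Z_k` at `some k`. -/
def summand (T : IPMap Y (Y.tensor M)) : Option ℕ → HilbertSubmodule (limit T)
  | none => subY T 0
  | some k => subZ T k

end MRA

end mra

end

section auxiliary

open HilbertModule Correspondence

variable {A : Type v} [NonUnitalCStarAlgebra A] [PartialOrder A] [StarOrderedRing A]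

/-! ### Inner-product preserving maps -/

/-! The engine is that orthogonal sums survive tensoring with `M` (`IsOrthogonalSum.tensor`). If the
range of `h` is the sum of the mutually orthogonal ranges of `f` and `g`, orthogonality and the two
inclusions pass to `f ⊗ id`, `g ⊗ id`, `h ⊗ id` by checking elementary tensors and taking limits.
The sum of two orthogonal ranges of isometries is closed, so the decomposition of elementary tensors
extends to the whole completed tensor product.

For the complements: an adjointable isometry `T` has range complemented by means of the projection
`T T*`. The engine carries this to each `T_k = T ⊗ id_k`, and `ι^{k+1} ∘ T_k = ι^k` transports it to
`Y_{k+1} = Y_k + Z_k`.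

For the direct sum: `Y_0, Z_0, Z_1, …` are pairwise orthogonal, so summation is an inner-product
preserving map on their Hilbert sum. Its range is closed and contains every `Y_k`, and the union of
the `Y_k` is dense.

For the shift: the maps `(ι^k ⊗ id) ∘ T_k` are compatible, so the universal property of the limit
yields `R`. Its closed range contains every `y ⊗ m` with `y` in some `Y_k`, hence, by continuity in
`y`, all elementary tensors. Since `R^{k+1} = (R^k ⊗ id) ∘ R`, there holds `R^{k+1} ∘ ι^{j+1} = (R^k
∘ ι^j) ⊗ id`. Inductively the engine then turns `Y_1 = Y_0 + Z_0` into the orthogonal sum of `R^k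
Y_k` and `Z_0 ⊗ M^{⊗ k}` inside `R^k Y_{k+1}`. Both `R^k Z_k` and `Z_0 ⊗ M^{⊗ k}` are the orthogonal
complement of `R^k Y_k` there, so they coincide. -/

lemma HilbertModule.ip_zero_right {X : HilbertModule.{u} A} (x : X) : ip x (0 : X) = 0 := by
  simpa using ip_smul_right 0 x (0 : X)

lemma HilbertModule.ip_eq_zero_symm {X : HilbertModule.{u} A} {x y : X} (h : ip x y = 0) :
    ip y x = 0 := by
  rw [← star_ip, h, star_zero]

namespace IPMap

lemma ext_fun {X : HilbertModule.{u} A} {Y : HilbertModule.{w} A} {f g : IPMap X Y}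
    (h : ∀ x, f x = g x) : f = g := by
  obtain ⟨f, hf⟩ := f
  obtain ⟨g, hg⟩ := g
  obtain rfl : f = g := LinearMap.ext h
  rfl

lemma isClosed_range {X : HilbertModule.{u} A} {Y : HilbertModule.{w} A} (f : IPMap X Y) :
    IsClosed (f.toLinearMap.range : Set Y) :=
  (HilbertSubmodule.range f).isClosed'

lemma comp_apply {X : HilbertModule.{u} A} {Y Z : HilbertModule.{w} A} (g : IPMap Y Z)
    (f : IPMap X Y) (x : X) : g.comp f x = g (f x) := rfl

lemma id_apply {X : HilbertModule.{u} A} (x : X) : IPMap.id X x = x := rfl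

end IPMap

lemma HilbertIso.ext_fun {X : HilbertModule.{u} A} {Y : HilbertModule.{w} A} {f g : HilbertIso X Y}
    (h : ∀ x, f x = g x) : f = g := by
  obtain ⟨f, hf⟩ := f
  obtain ⟨g, hg⟩ := g
  obtain rfl : f = g := IPMap.ext_fun h
  rfl

/-- An inner-product preserving map whose values lie in the range of `g` factors through `g`. -/
lemma IPMap.exists_factor {X : HilbertModule.{u} A} {Y V : HilbertModule.{w} A} (f : IPMap X V)
    (g : IPMap Y V) (h : ∀ x, f x ∈ g.toLinearMap.range) :
    ∃ φ : IPMap X Y, ∀ x, g (φ x) = f x := by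
  choose φ hφ using h
  have hinj : Function.Injective g := g.isometry.injective
  refine ⟨⟨⟨⟨φ, fun x y => hinj ?_⟩, fun c x => hinj ?_⟩, fun x y => ?_⟩, hφ⟩
  · rw [map_add, hφ, hφ, hφ, map_add]
  · rw [map_smul, hφ, hφ, map_smul, RingHom.id_apply]
  · rw [← g.ip_map, ← f.ip_map]
    exact congrArg₂ ip (hφ x) (hφ y)

/-! ### Elementary tensors -/

section elementary

variable {X : HilbertModule.{u} A} {M : Correspondence.{u} A}

lemma HilbertModule.ip_tmul (x y : X) (m n : M.toHilbertModule) :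
    ip (tmul x m) (tmul y n) = ip m (M.lact (ip x y) n) :=
  PreHilbert.ip_toCompletion _ _ _

/-- A closed subspace of `X ⊗_A M` that contains the elementary tensors is everything. -/
lemma HilbertModule.tensor_mem_of_tmul_mem (S : Submodule ℂ (X.tensor M))
    (hS : IsClosed (S : Set (X.tensor M))) (h : ∀ (x : X) (m : M.toHilbertModule), tmul x m ∈ S)
    (t : X.tensor M) : t ∈ S := by
  refine (preTensor X M).denseRange_toCompletion.induction_on (p := fun t => t ∈ S) t hS
    fun s => ?_
  induction s with
  | zero => rw [map_zero]; exact S.zero_mem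
  | add s s' hs hs' => rw [map_add]; exact S.add_mem hs hs'
  | tmul x m => exact h x m

lemma IPMap.eq_of_tmul_eq {V : HilbertModule.{w} A} {f g : IPMap (X.tensor M) V}
    (h : ∀ (x : X) (m : M.toHilbertModule), f (tmul x m) = g (tmul x m)) : f = g := by
  refine IPMap.ext_fun fun t => tensor_mem_of_tmul_mem (LinearMap.eqLocus f.toLinearMap
    g.toLinearMap) ?_ h t
  exact isClosed_eq f.isometry.continuous g.isometry.continuous

lemma IPMap.tensor_comp {X' X'' : HilbertModule.{u} A} (g : IPMap X' X'') (f : IPMap X X') :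
    (g.comp f).tensor M = (g.tensor M).comp (f.tensor M) :=
  eq_of_tmul_eq fun x m => by
    rw [comp_apply, tensor_tmul, tensor_tmul, tensor_tmul, comp_apply]

lemma IPMap.tensor_id : (IPMap.id X).tensor M = IPMap.id (X.tensor M) :=
  eq_of_tmul_eq fun x m => by rw [tensor_tmul, id_apply, id_apply]

/-- The positive map `a ↦ ⟨m, a · m⟩`. -/
def Correspondence.vectorMap (M : Correspondence.{u} A) (m : M.toHilbertModule) : A →ₚ[ℂ] A :=
  PositiveLinearMap.mk₀
    { toFun := fun a => ip m (M.lact a m)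
      map_add' := fun a b => by simp [ip_add_right]
      map_smul' := fun c a => by simp [ip_smul_right] } fun a ha => by
    -- For `a = c* c` the value is `⟨c · m, c · m⟩`, which is positive.
    obtain ⟨c, rfl⟩ := exists_eq_star_mul_self ha
    change 0 ≤ ip m (M.lact (star c * c) m)
    rw [map_mul, mul_apply_eq_comp, ip_lact, star_star]
    exact ip_self_nonneg _

/-- A positive linear map on a C⋆-algebra is bounded. Applied to `a ↦ ⟨m, a · m⟩` this gives `‖x ⊗
m‖² ≤ C ‖⟨x, x⟩‖ = C ‖x‖²`. It lets surjectivity onto a tensor product be checked on `x ⊗ m` with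
`x` in a dense set only. -/
lemma HilbertModule.continuous_tmul_left (m : M.toHilbertModule) :
    Continuous fun x : X => (tmul x m : X.tensor M) := by
  let F : X →ₗ[ℂ] X.tensor M :=
    (preTensor X M).toCompletion ∘ₗ (TensorProduct.mk ℂ X M.toHilbertModule).flip m
  obtain ⟨C, hC⟩ := (M.vectorMap m).exists_norm_apply_le
  refine (F.mkContinuous √C fun x => ?_).continuous
  have h : ‖ip (tmul x m : X.tensor M) (tmul x m)‖ ≤ C * ‖ip x x‖ := by
    rw [ip_tmul]; exact hC (ip x x)
  calc ‖F x‖ = √‖ip (tmul x m : X.tensor M) (tmul x m)‖ := norm_eq _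
    _ ≤ √(C * ‖ip x x‖) := Real.sqrt_le_sqrt h
    _ = √C * ‖x‖ := by rw [Real.sqrt_mul C.coe_nonneg, norm_eq x]

/-- Tensoring with `M` preserves surjectivity. -/
lemma IPMap.tensor_surjective {X' : HilbertModule.{u} A} {f : IPMap X X'}
    (hf : Function.Surjective f) : Function.Surjective (f.tensor M) := by
  intro t
  refine tensor_mem_of_tmul_mem (f.tensor M).toLinearMap.range (f.tensor M).isClosed_range
    (fun x m => ?_) t
  obtain ⟨x, rfl⟩ := hf x
  exact ⟨tmul x m, f.tensor_tmul M x m⟩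

end elementary

/-! ### Orthogonal decompositions -/

/-- The range of `h` is the orthogonal sum of the ranges of `f` and `g`. -/
structure IsOrthogonalSum {X W H V : HilbertModule.{u} A} (f : IPMap X V) (g : IPMap W V)
    (h : IPMap H V) : Prop where
  ip_eq_zero : ∀ x w, ip (f x) (g w) = 0
  left_mem : ∀ x, f x ∈ h.toLinearMap.range
  right_mem : ∀ w, g w ∈ h.toLinearMap.range
  exists_add : ∀ y, ∃ x w, f x + g w = h y

section decomposition

variable {X W H V : HilbertModule.{u} A}

/-- The sum of the ranges of two orthogonal inner-product preserving maps is closed. -/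
lemma IPMap.isClosed_range_sup_range {f : IPMap X V} {g : IPMap W V}
    (hfg : ∀ x w, ip (f x) (g w) = 0) :
    IsClosed (f.toLinearMap.range ⊔ g.toLinearMap.range : Submodule ℂ V).carrier := by
  let F : (X × W) →ₗ[ℂ] V := f.toLinearMap.coprod g.toLinearMap
  have hF : ∀ p, F p = f p.1 + g p.2 := fun p => LinearMap.coprod_apply _ _ _
  have hcont : Continuous F := by
    have : (F : X × W → V) = fun p => f p.1 + g p.2 := funext hF
    rw [this]
    exact (f.isometry.continuous.comp continuous_fst).add
      (g.isometry.continuous.comp continuous_snd)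
  -- If `a ⊥ b` then `⟨a, a + b⟩ = ⟨a, a⟩`, and Cauchy-Schwarz gives `‖a‖² ≤ ‖a‖ ‖a + b‖`.
  have bound : ∀ a b : V, ip a b = 0 → ‖a‖ ≤ ‖a + b‖ := by
    intro a b hab
    by_contra! hlt
    have ha : 0 < ‖a‖ := (norm_nonneg _).trans_lt hlt
    have h1 : ‖a‖ ^ 2 = ‖ip a (a + b)‖ := by
      rw [ip_add_right, hab, add_zero, norm_eq, Real.sq_sqrt (norm_nonneg _)]
    have h2 := norm_ip_le a (a + b)
    nlinarith
  -- By `bound`, the sup norm of `(x, w)` is at most `‖f x + g w‖`. Since `X × W` is complete, the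
  -- range of `F` is closed.
  have hanti : AntilipschitzWith 1 F := by
    refine AddMonoidHomClass.antilipschitz_of_bound F fun p => ?_
    rw [NNReal.coe_one, one_mul, hF, Prod.norm_def]
    refine max_le ?_ ?_
    · rw [← f.norm_map]; exact bound _ _ (hfg _ _)
    · rw [← g.norm_map, add_comm]; exact bound _ _ (ip_eq_zero_symm (hfg _ _))
  have hu : UniformContinuous F := uniformContinuous_addMonoidHom_of_continuous
    (f := F.toAddMonoidHom) hcont
  have := hanti.isClosed_range hu
  rwa [← LinearMap.coe_range, LinearMap.range_coprod] at this

/-- The elements orthogonal to `v` form a closed subspace. -/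
def HilbertModule.orthogonal (v : V) : Submodule ℂ V where
  carrier := {x | ip v x = 0}
  add_mem' := fun {x y} hx hy => by
    change ip v (x + y) = 0
    rw [ip_add_right, hx, hy, add_zero]
  zero_mem' := ip_zero_right v
  smul_mem' := fun c x hx => by
    change ip v (c • x) = 0
    rw [ip_smul_right, hx, smul_zero]

lemma HilbertModule.isClosed_orthogonal (v : V) : IsClosed (orthogonal v : Set V) :=
  isClosed_eq (continuous_ip.comp (by fun_prop : Continuous fun x : V => (v, x))) continuous_const

/-- On elementary tensors the inner product is `⟨m, ⟨f x, g w⟩ · n⟩ = 0`. Orthogonality to a fixed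
vector is a closed linear condition, so each variable in turn can be reduced to that case. -/
lemma IPMap.ip_tensor_eq_zero {f : IPMap X V} {g : IPMap W V} (hfg : ∀ x w, ip (f x) (g w) = 0)
    (M : Correspondence.{u} A) (s : X.tensor M) (t : W.tensor M) :
    ip (f.tensor M s) (g.tensor M t) = 0 := by
  refine tensor_mem_of_tmul_mem
    ((orthogonal (f.tensor M s)).comap (g.tensor M).toLinearMap)
    ((isClosed_orthogonal _).preimage (g.tensor M).isometry.continuous) (fun w n => ?_) t
  refine ip_eq_zero_symm ?_
  refine tensor_mem_of_tmul_mem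
    ((orthogonal (g.tensor M (tmul w n))).comap (f.tensor M).toLinearMap)
    ((isClosed_orthogonal _).preimage (f.tensor M).isometry.continuous) (fun x m => ?_) s
  refine ip_eq_zero_symm ?_
  rw [tensor_tmul, tensor_tmul, ip_tmul, hfg]
  simp [ip_zero_right]

lemma IPMap.tensor_mem_range {f : IPMap X V} {h : IPMap H V}
    (hf : ∀ x, f x ∈ h.toLinearMap.range) (M : Correspondence.{u} A) (s : X.tensor M) :
    f.tensor M s ∈ (h.tensor M).toLinearMap.range := by
  refine tensor_mem_of_tmul_mem ((h.tensor M).toLinearMap.range.comap (f.tensor M).toLinearMap)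
    ((h.tensor M).isClosed_range.preimage (f.tensor M).isometry.continuous) (fun x m => ?_) s
  obtain ⟨y, hy⟩ := hf x
  refine ⟨tmul y m, ?_⟩
  exact (h.tensor_tmul M y m).trans (((congrArg (tmul · m) hy)).trans (f.tensor_tmul M x m).symm)

/-- The point is `exists_add`: splitting `h y = f x + g w` splits `h y ⊗ m`, but a general element
is only a limit of sums of such tensors. Closedness of the sum of the orthogonal ranges is what
makes the limit split as well. -/
lemma IsOrthogonalSum.tensor {f : IPMap X V} {g : IPMap W V} {h : IPMap H V}
    (hs : IsOrthogonalSum f g h) (M : Correspondence.{u} A) :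
    IsOrthogonalSum (f.tensor M) (g.tensor M) (h.tensor M) where
  ip_eq_zero := IPMap.ip_tensor_eq_zero hs.ip_eq_zero M
  left_mem := IPMap.tensor_mem_range hs.left_mem M
  right_mem := IPMap.tensor_mem_range hs.right_mem M
  exists_add t := by
    have key : h.tensor M t ∈ (f.tensor M).toLinearMap.range ⊔ (g.tensor M).toLinearMap.range := by
      refine tensor_mem_of_tmul_mem (Submodule.comap (h.tensor M).toLinearMap
        ((f.tensor M).toLinearMap.range ⊔ (g.tensor M).toLinearMap.range))
        ((IPMap.isClosed_range_sup_range (IPMap.ip_tensor_eq_zero hs.ip_eq_zero M)).preimage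
          (h.tensor M).isometry.continuous) (fun y m => ?_) t
      obtain ⟨x, w, hxw⟩ := hs.exists_add y
      refine Submodule.mem_sup.mpr ⟨_, ⟨tmul x m, rfl⟩, _, ⟨tmul w m, rfl⟩, ?_⟩
      rw [IPMap.tensor_tmul, IPMap.tensor_tmul, IPMap.tensor_tmul, ← hxw]
      change _ = (preTensor V M).toCompletion ((f x + g w) ⊗ₜ m)
      rw [TensorProduct.add_tmul, map_add]
      rfl
    obtain ⟨_, ⟨s, rfl⟩, _, ⟨t', rfl⟩, hst⟩ := Submodule.mem_sup.mp key
    exact ⟨s, t', hst⟩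

/-- The range of `f` is orthogonally complemented. -/
def IPMap.IsComplemented (f : IPMap X V) : Prop :=
  ∀ y, ∃ x z, f x + z = y ∧ ∀ x', ip (f x') z = 0

/-- With `g` the adjoint, `f ∘ g` is the projection onto the range: `⟨f x', y⟩ = ⟨x', g y⟩ = ⟨f x',
f (g y)⟩`. -/
lemma IPMap.IsAdjointable.isComplemented {f : IPMap X V} (hf : f.IsAdjointable) :
    f.IsComplemented := by
  obtain ⟨g, hg⟩ := hf
  refine fun y => ⟨g y, y - f (g y), by abel, fun x' => ?_⟩
  rw [ip_sub_right, f.ip_map, hg, sub_self]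

/-- Complementedness is tensored rather than the adjoint, which need not preserve inner products and
so falls outside `IPMap.tensor`. -/
lemma IPMap.IsComplemented.tensor {f : IPMap X V} (hf : f.IsComplemented)
    (M : Correspondence.{u} A) : (f.tensor M).IsComplemented := by
  -- The range of the identity is all of `V` as a closed submodule, so `W` is the orthogonal
  -- complement of the range of `f`.
  let W := (HilbertSubmodule.range (IPMap.id V)).ominus (HilbertSubmodule.range f)
  have hs : IsOrthogonalSum f W.incl (IPMap.id V) :=
    { ip_eq_zero := fun x w => w.2.2 (f x) ⟨x, rfl⟩
      left_mem := fun x => ⟨f x, rfl⟩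
      right_mem := fun w => ⟨W.incl w, rfl⟩
      exists_add := fun y => by
        obtain ⟨x, z, hxz, hz⟩ := hf y
        refine ⟨x, ⟨z, ⟨z, rfl⟩, ?_⟩, hxz⟩
        rintro _ ⟨x', rfl⟩
        exact hz x' }
  intro t
  obtain ⟨s, w, hsw⟩ := (hs.tensor M).exists_add t
  rw [IPMap.tensor_id] at hsw
  exact ⟨s, W.incl.tensor M w, hsw, fun x' => (hs.tensor M).ip_eq_zero x' w⟩

lemma IPMap.IsComplemented.tensorStep {M : Correspondence.{u} A} {f : IPMap X (V.tensor M)}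
    (hf : f.IsComplemented) : ∀ k, (f.tensorStep k).IsComplemented
  | 0 => hf
  | k + 1 => (hf.tensorStep k).tensor M

end decomposition

/-! ### Iterates -/

section iterates

variable {X : HilbertModule.{u} A} {M : Correspondence.{u} A}

/-- The definition applies `U ⊗ id_k` last; here `U` is applied first. This form is the useful one,
because the next tensor factor then sits on the outside and statements about `U^k` can be tensored
with `M`. -/
lemma IPMap.iterate_succ_eq (U : IPMap X (X.tensor M)) :
    ∀ k, U.iterate (k + 1) = ((U.iterate k).tensor M).comp U
  | 0 => by
    change U.comp (IPMap.id X) = ((IPMap.id X).tensor M).comp U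
    rw [tensor_id]; rfl
  | k + 1 => by
    change ((U.tensorStep k).tensor M).comp (U.iterate (k + 1)) =
      (((U.tensorStep k).comp (U.iterate k)).tensor M).comp U
    rw [U.iterate_succ_eq k, tensor_comp]; rfl

lemma IPMap.iterate_surjective {U : IPMap X (X.tensor M)} (hU : Function.Surjective U) :
    ∀ k, Function.Surjective (U.iterate k)
  | 0 => fun x => ⟨x, rfl⟩
  | k + 1 => by
    rw [U.iterate_succ_eq k]
    exact (tensor_surjective (iterate_surjective hU k)).comp hU

end iterates

/-! ### Direct limits -/

section limits

variable {X : ℕ → HilbertModule.{u} A} {T : ∀ k, IPMap (X k) (X (k + 1))}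

lemma PreHilbert.toCompletion_eq {E : Type u} [AddCommGroup E] [Module ℂ E] (P : PreHilbert A E)
    {x y : E} (h : P.ip (x - y) (x - y) = 0) : P.toCompletion x = P.toCompletion y := by
  rw [← sub_eq_zero, ← map_sub, ← ip_self_eq_zero, ip_toCompletion, h]

/-- Sequences that agree for all large indices define the same element of the limit. -/
lemma HilbertLimit.toCompletion_eq {x y : seqs X T} (h : ∀ᶠ k in Filter.atTop, x.1 k = y.1 k) :
    (pre X T).toCompletion x = (pre X T).toCompletion y := by
  refine (pre X T).toCompletion_eq ?_
  obtain ⟨k, h1, h2⟩ := ((eventually_seqIp X T (x - y) (x - y)).and h).exists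
  refine h1.trans (ip_self_eq_zero.mpr ?_)
  exact sub_eq_zero.mpr h2

lemma HilbertLimit.transition_self (k : ℕ) (x : X k) : transition X T (le_refl k) x = x := by
  unfold transition
  rw [Nat.leRecOn_self]; rfl

lemma HilbertLimit.toSeqs_apply {k j : ℕ} (h : k ≤ j) (x : X k) :
    (toSeqs X T k x).1 j = transition X T h x := dif_pos h

/-- A sequence `x` with `x_{k+1} = T_k x_k` for `k ≥ N` represents `ι^N x_N`. -/
lemma HilbertLimit.toCompletion_eq_ι (x : seqs X T) {N : ℕ}
    (hN : ∀ k ≥ N, x.1 (k + 1) = T k (x.1 k)) :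
    (pre X T).toCompletion x = directLimit.ι X T N (x.1 N) := by
  refine toCompletion_eq (Filter.eventually_atTop.mpr ⟨N, fun k hk => ?_⟩)
  rw [toSeqs_apply hk]
  induction k, hk using Nat.le_induction with
  | base => rw [transition_self]
  | succ k hk ih => rw [hN k hk, ih]; exact (transition_succ X T hk _).symm

lemma directLimit.ι_succ (k : ℕ) (x : X k) :
    directLimit.ι X T (k + 1) (T k x) = directLimit.ι X T k x := by
  -- The sequence representing `ι^k x` obeys the recursion from index `k`, hence also from `k + 1`.
  -- It is therefore represented by its entry at `k + 1`, which is `T_k x`.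
  have h := HilbertLimit.toCompletion_eq_ι (HilbertLimit.toSeqs X T k x) (N := k + 1)
    fun j hj => by
      have hj' : k ≤ j := (Nat.le_succ k).trans hj
      rw [HilbertLimit.toSeqs_apply hj', HilbertLimit.toSeqs_apply (Nat.le_succ_of_le hj'),
        HilbertLimit.transition_succ]
  rw [HilbertLimit.toSeqs_apply (Nat.le_succ k), HilbertLimit.transition_succ X T le_rfl,
    HilbertLimit.transition_self] at h
  exact h.symm

/-- A closed set that contains the images of all `ι^k` is everything. -/
lemma directLimit.mem_of_ι_mem {S : Set (directLimit X T)} (hS : IsClosed S)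
    (h : ∀ k x, directLimit.ι X T k x ∈ S) (y : directLimit X T) : y ∈ S := by
  refine (HilbertLimit.pre X T).denseRange_toCompletion.induction_on (p := fun t => t ∈ S) y hS
    fun x => ?_
  obtain ⟨N, hN⟩ := x.2
  rw [HilbertLimit.toCompletion_eq_ι x hN]
  exact h N _

variable {V : HilbertModule.{w} A}

/-- The eventually constant value of `g_k x_k`, for compatible maps `g_k : X_k → V`. -/
lemma HilbertLimit.eventually_limUnder_eq {g : ∀ k, IPMap (X k) V}
    (hg : ∀ k x, g (k + 1) (T k x) = g k x) (x : seqs X T) :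
    ∀ᶠ k in Filter.atTop, (Filter.atTop.limUnder fun k => g k (x.1 k)) = g k (x.1 k) := by
  obtain ⟨N, hN⟩ := x.2
  have h : ∀ k ≥ N, g k (x.1 k) = g N (x.1 N) := by
    intro k hk
    induction k, hk using Nat.le_induction with
    | base => rfl
    | succ k hk ih => rw [hN k hk, hg, ih]
  have h2 : (Filter.atTop.limUnder fun k => g k (x.1 k)) = g N (x.1 N) :=
    (tendsto_const_nhds.congr' (Filter.eventually_atTop.mpr
      ⟨N, fun k hk => (h k hk).symm⟩)).limUnder_eq
  exact Filter.eventually_atTop.mpr ⟨N, fun k hk => h2.trans (h k hk).symm⟩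

/-- The universal property of the direct limit. -/
lemma directLimit.exists_lift {g : ∀ k, IPMap (X k) V}
    (hg : ∀ k x, g (k + 1) (T k x) = g k x) :
    ∃ G : IPMap (directLimit X T) V, ∀ k x, G (directLimit.ι X T k x) = g k x := by
  have ev := HilbertLimit.eventually_limUnder_eq hg
  -- On a sequence, `f` takes the value at which `g_k x_k` stabilises. Each identity below is
  -- verified at one index where all the sequences involved have stabilised.
  let f : HilbertLimit.seqs X T →ₗ[ℂ] V :=
    { toFun := fun x => Filter.atTop.limUnder fun k => g k (x.1 k)
      map_add' := fun x y => by
        obtain ⟨k, h1, h2, h3⟩ := ((ev (x + y)).and ((ev x).and (ev y))).exists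
        rw [h1, h2, h3]; exact map_add _ _ _
      map_smul' := fun c x => by
        obtain ⟨k, h1, h2⟩ := ((ev (c • x)).and (ev x)).exists
        rw [h1, h2]; exact map_smul _ _ _ }
  have hf : ∀ x y, ip (f x) (f y) = (HilbertLimit.pre X T).ip x y := by
    intro x y
    obtain ⟨k, h1, h2, h3⟩ := ((HilbertLimit.eventually_seqIp X T x y).and
      ((ev x).and (ev y))).exists
    refine Eq.trans ?_ h1.symm
    rw [← (g k).ip_map]
    exact congrArg₂ ip h2 h3
  refine ⟨(HilbertLimit.pre X T).extend f hf, fun k x => ?_⟩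
  refine ((HilbertLimit.pre X T).extend_toCompletion f hf _).trans ?_
  obtain ⟨j, h1, hj⟩ := ((ev (HilbertLimit.toSeqs X T k x)).and
    (Filter.eventually_ge_atTop k)).exists
  refine h1.trans ?_
  rw [HilbertLimit.toSeqs_apply hj]
  clear h1
  induction j, hj using Nat.le_induction with
  | base => rw [HilbertLimit.transition_self]
  | succ j hj ih => rw [HilbertLimit.transition_succ X T hj, hg, ih]

end limits

/-! ### Orthogonal families of submodules -/

section families

variable {ι : Type} {X : HilbertModule.{u} A} {V : ι → HilbertSubmodule X}

lemma hilbertSum.summable_ip_component (w : hilbertSum fun i => (V i).toModule) :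
    Summable fun i => ip (component w i) (component w i) :=
  (show HilbertSum.families (fun i => (V i).toModule) from w).2

lemma HilbertSubmodule.ip_sum_sum (hV : ∀ i j, i ≠ j → ∀ x ∈ V i, ∀ y ∈ V j, ip x y = 0)
    (s : Finset ι) (x y : ∀ i, (V i).toModule) :
    ip (∑ i ∈ s, (V i).incl (x i)) (∑ i ∈ s, (V i).incl (y i)) =
      ∑ i ∈ s, ip (x i) (y i) := by
  rw [ip_sum_left]
  refine Finset.sum_congr rfl fun i hi => ?_
  rw [ip_sum_right, Finset.sum_eq_single_of_mem i hi fun j _ hj => ?_]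
  · exact (V i).incl.ip_map _ _
  · exact hV i j hj.symm _ (x i).2 _ (y j).2

lemma hilbertSum.summable_incl (hV : ∀ i j, i ≠ j → ∀ x ∈ V i, ∀ y ∈ V j, ip x y = 0)
    (w : hilbertSum fun i => (V i).toModule) :
    Summable fun i => (V i).incl (component w i) := by
  rw [summable_iff_vanishing_norm]
  intro ε hε
  -- By orthogonality the squared norm of a finite partial sum is the norm of the matching partial
  -- sum of `∑ ⟨w_i, w_i⟩`; hence the tolerance `ε ^ 2`.
  obtain ⟨s, hs⟩ := summable_iff_vanishing_norm.mp (summable_ip_component w) (ε ^ 2) (by positivity)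
  refine ⟨s, fun t ht => ?_⟩
  rw [norm_eq, HilbertSubmodule.ip_sum_sum hV]
  rw [Real.sqrt_lt' hε]
  exact hs t ht

/-- The family with value `v` at `i` and `0` elsewhere. -/
lemma hilbertSum.exists_single (i : ι) (v : (V i).toModule) :
    ∃ w : hilbertSum fun i => (V i).toModule,
      component w i = v ∧ ∀ j, j ≠ i → component w j = 0 := by
  classical
  have hmem : Pi.single i v ∈ HilbertSum.families fun i => (V i).toModule := by
    refine summable_of_ne_finset_zero (s := {i}) fun j hj => ?_
    rw [Finset.mem_singleton] at hj
    rw [Pi.single_eq_of_ne hj]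
    exact ip_self_eq_zero.mpr rfl
  exact ⟨(⟨Pi.single i v, hmem⟩ : HilbertSum.families fun i => (V i).toModule),
    Pi.single_eq_same (M := fun i => (V i).toModule.carrier) i v,
    fun j hj => Pi.single_eq_of_ne (M := fun i => (V i).toModule.carrier) hj v⟩

/-- Summation of orthogonal families. -/
noncomputable def hilbertSum.sumMap (hV : ∀ i j, i ≠ j → ∀ x ∈ V i, ∀ y ∈ V j, ip x y = 0) :
    IPMap (hilbertSum fun i => (V i).toModule) X where
  toFun w := ∑' i, (V i).incl (component w i)
  map_add' w w' := by
    rw [← (summable_incl hV w).tsum_add (summable_incl hV w')]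
    exact tsum_congr fun i => map_add _ _ _
  map_smul' c w := by
    rw [RingHom.id_apply, ← (summable_incl hV w).tsum_const_smul c]
    exact tsum_congr fun i => (V i).incl.toLinearMap.map_smul c (component w i)
  ip_map' w w' := by
    -- The inner products of the finite partial sums converge to the inner product of the full sums.
    -- By orthogonality they are also the partial sums of `∑ ⟨w_i, w'_i⟩`, so the two limits agree.
    have h1 : Filter.Tendsto (fun s : Finset ι => ip (∑ i ∈ s, (V i).incl (component w i))
        (∑ i ∈ s, (V i).incl (component w' i))) Filter.atTop
        (nhds (ip (∑' i, (V i).incl (component w i)) (∑' i, (V i).incl (component w' i)))) :=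
      (continuous_ip.tendsto _).comp
        ((summable_incl hV w).hasSum.prodMk_nhds (summable_incl hV w').hasSum)
    simp only [HilbertSubmodule.ip_sum_sum hV] at h1
    exact tendsto_nhds_unique h1 (HilbertSum.summable_ip _ (summable_ip_component w)
      (summable_ip_component w')).hasSum

lemma hilbertSum.hasSum_sumMap (hV : ∀ i j, i ≠ j → ∀ x ∈ V i, ∀ y ∈ V j, ip x y = 0)
    (w : hilbertSum fun i => (V i).toModule) :
    HasSum (fun i => (V i).incl (component w i)) (sumMap hV w) :=
  (summable_incl hV w).hasSum

lemma hilbertSum.mem_range_sumMap (hV : ∀ i j, i ≠ j → ∀ x ∈ V i, ∀ y ∈ V j, ip x y = 0)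
    {i : ι} {x : X} (hx : x ∈ V i) : x ∈ (sumMap hV).toLinearMap.range := by
  obtain ⟨w, h1, h2⟩ := exists_single (V := V) i ⟨x, hx⟩
  refine ⟨w, (hasSum_sumMap hV w).unique ?_⟩
  have h3 : HasSum (fun j => (V j).incl (component w j)) ((V i).incl (component w i)) :=
    hasSum_single i fun j hj => by rw [h2 j hj, map_zero]
  rwa [h1] at h3

end families

/-- Splitting off the term at `none`. -/
lemma HasSum.some_of_option {α E : Type*} [AddCommGroup E] [TopologicalSpace E]
    [IsTopologicalAddGroup E] {f : Option α → E} {s : E} (h : HasSum f s) :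
    HasSum (fun k => f (some k)) (s - f none) := by
  classical
  -- Setting the term at `none` to zero changes the sum by `-f none`, and the new family is
  -- supported on the range of `some`.
  have h1 := h.update none 0
  have h2 := (Option.some_injective α).hasSum_iff (f := Function.update f none 0)
    (a := 0 - f none + s) fun x hx => by
      cases x with
      | none => simp
      | some k => exact absurd ⟨k, rfl⟩ hx
  rw [zero_sub, neg_add_eq_sub] at h1 h2
  have h3 := h2.mpr h1
  have e : Function.update f none 0 ∘ some = fun k => f (some k) := by
    funext k; simp
  rwa [e] at h3

/-! ### The multi-resolution analysis -/

namespace MRA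

variable {M : Correspondence.{u} A} {Y : HilbertModule.{u} A} {T : IPMap Y (Y.tensor M)}

lemma ι_succ (k : ℕ) (x : Y.tensorPow M k) : ι T (k + 1) (T.tensorStep k x) = ι T k x :=
  directLimit.ι_succ (X := fun k => Y.tensorPow M k) (T := T.tensorStep) k x

lemma mem_of_ι_mem {S : Set (limit T)} (hS : IsClosed S) (h : ∀ k x, ι T k x ∈ S)
    (y : limit T) : y ∈ S :=
  directLimit.mem_of_ι_mem hS h y

lemma subY_le_succ (k : ℕ) {y : limit T} (hy : y ∈ subY T k) : y ∈ subY T (k + 1) := by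
  obtain ⟨x, rfl⟩ := hy
  exact ⟨T.tensorStep k x, ι_succ k x⟩

lemma subY_mono {j k : ℕ} (h : j ≤ k) {y : limit T} (hy : y ∈ subY T j) : y ∈ subY T k := by
  induction k, h using Nat.le_induction with
  | base => exact hy
  | succ k _ ih => exact subY_le_succ k ih

/-- The complement of the range of `T_k` is carried into `Y_∞` by the isometry `ι^{k+1}`, which maps
that range onto `Y_k` because `ι^{k+1} ∘ T_k = ι^k`. -/
lemma exists_add_of_mem_subY (hT : T.IsAdjointable) (k : ℕ) {y : limit T}
    (hy : y ∈ subY T (k + 1)) : ∃ p ∈ subY T k, ∃ q ∈ subZ T k, y = p + q := by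
  obtain ⟨y, rfl⟩ := hy
  obtain ⟨x, z, rfl, hz⟩ := hT.isComplemented.tensorStep k y
  refine ⟨ι T k x, ⟨x, rfl⟩, ι T (k + 1) z, ⟨⟨z, rfl⟩, ?_⟩, ?_⟩
  · rintro _ ⟨x', rfl⟩
    rw [← ι_succ, IPMap.ip_map, hz]
  · rw [map_add, ι_succ]

lemma summand_orthogonal (i j : Option ℕ) (hij : i ≠ j) (x : limit T) (hx : x ∈ summand T i)
    (y : limit T) (hy : y ∈ summand T j) : ip x y = 0 := by
  -- For `k < l`, that is `k + 1 ≤ l`, one has `Z_k ⊂ Y_{k+1} ⊂ Y_l`, and `Z_l` is orthogonal to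
  -- `Y_l`.
  have aux : ∀ {k l : ℕ}, k < l → ∀ x ∈ subZ T k, ∀ y ∈ subZ T l, ip x y = 0 :=
    fun h x hx y hy => hy.2 x (subY_mono h hx.1)
  match i, j with
  | none, none => exact absurd rfl hij
  | none, some l => exact hy.2 x (subY_mono (Nat.zero_le l) hx)
  | some k, none => exact ip_eq_zero_symm (hx.2 y (subY_mono (Nat.zero_le k) hy))
  | some k, some l =>
    rcases lt_trichotomy k l with h | rfl | h
    · exact aux h x hx y hy
    · exact absurd rfl hij
    · exact ip_eq_zero_symm (aux h y hy x hx)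

/-- Iterating `Y_{k+1} = Y_k + Z_k` writes `Y_k` as the finite sum `Y_0 + Z_0 + ⋯ + Z_{k-1}`. -/
lemma mem_range_sumMap_of_mem_subY (hT : T.IsAdjointable) (k : ℕ) {y : limit T}
    (hy : y ∈ subY T k) : y ∈ (hilbertSum.sumMap (summand_orthogonal (T := T))).toLinearMap.range := by
  induction k generalizing y with
  | zero => exact hilbertSum.mem_range_sumMap summand_orthogonal (i := none) hy
  | succ k ih =>
    obtain ⟨p, hp, q, hq, rfl⟩ := exists_add_of_mem_subY hT k hy
    exact Submodule.add_mem _ (ih hp)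
      (hilbertSum.mem_range_sumMap summand_orthogonal (i := some k) hq)

/-- The decomposition `Y_∞ = Y_0 ⊕ (⨁_k Z_k)`. -/
lemma exists_decomposition (hT : T.IsAdjointable) :
    ∃ S : HilbertIso (hilbertSum fun i => (summand T i).toModule) (limit T),
      ∀ w, HasSum (fun k : ℕ => (summand T (some k)).incl (hilbertSum.component w (some k)))
        (S w - (summand T none).incl (hilbertSum.component w none)) := by
  refine ⟨⟨hilbertSum.sumMap summand_orthogonal, fun y => ?_⟩, fun w =>
    (hilbertSum.hasSum_sumMap summand_orthogonal w).some_of_option⟩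
  -- The range of an isometry from a complete space is closed, so containing the dense union of the
  -- `Y_k` makes it everything.
  exact mem_of_ι_mem (hilbertSum.sumMap (summand_orthogonal (T := T))).isClosed_range
    (fun k x => mem_range_sumMap_of_mem_subY hT k ⟨x, rfl⟩) y

lemma exists_shift (T : IPMap Y (Y.tensor M)) :
    ∃ R : HilbertIso (limit T) ((limit T).tensor M),
      ∀ k x, R (ι T (k + 1) x) = (ι T k).tensor M x := by
  -- This is `ι^{k+1} ∘ T_k = ι^k` tensored with `M`, since `T_{k+1} = T_k ⊗ id` by definition.
  have key : ∀ k (x : Y.tensorPow M (k + 1)),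
      (ι T (k + 1)).tensor M (T.tensorStep (k + 1) x) = (ι T k).tensor M x := by
    intro k x
    have h : (ι T (k + 1)).comp (T.tensorStep k) = ι T k := IPMap.ext_fun fun x => ι_succ k x
    rw [← h, IPMap.tensor_comp]; rfl
  -- The condition prescribes `R` only from level 1 on. Precomposing `ι^k ⊗ id` with `T_k` produces
  -- a map out of level `k` itself, level 0 included.
  obtain ⟨R, hR⟩ := directLimit.exists_lift (X := fun k => Y.tensorPow M k) (T := T.tensorStep)
    (g := fun k => ((ι T k).tensor M).comp (T.tensorStep k)) fun k x => key k (T.tensorStep k x)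
  have hR' : ∀ k x, R (ι T (k + 1) x) = (ι T k).tensor M x := fun k x =>
    (hR (k + 1) x).trans (key k x)
  refine ⟨⟨R, fun t => ?_⟩, hR'⟩
  refine tensor_mem_of_tmul_mem R.toLinearMap.range R.isClosed_range (fun y m => ?_) t
  -- For fixed `m`, the `y` with `y ⊗ m` in the range form a closed set, and `ι^k x ⊗ m = R (ι^{k+1}
  -- (x ⊗ m))`.
  refine mem_of_ι_mem (S := {y | tmul y m ∈ R.toLinearMap.range})
    (R.isClosed_range.preimage (continuous_tmul_left m)) (fun k x => ?_) y
  exact ⟨ι T (k + 1) (tmul x m : (Y.tensorPow M k).tensor M),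
    (hR' k _).trans (IPMap.tensor_tmul _ _ _ _)⟩

lemma shift_unique {R R' : HilbertIso (limit T) ((limit T).tensor M)}
    (hR : ∀ k x, R (ι T (k + 1) x) = (ι T k).tensor M x)
    (hR' : ∀ k x, R' (ι T (k + 1) x) = (ι T k).tensor M x) : R' = R := by
  refine HilbertIso.ext_fun fun y => mem_of_ι_mem (S := {y | R' y = R y})
    (isClosed_eq R'.toIPMap.isometry.continuous R.toIPMap.isometry.continuous) (fun k x => ?_) y
  change R' (ι T k x) = R (ι T k x)
  -- Moving up one level turns `ι^k x` into a vector on which both maps are prescribed, even for `k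
  -- = 0`.
  rw [← ι_succ, hR, hR']

/-- `R^k Y_{k+1}` is the orthogonal sum of `R^k Y_k` and `Z_0 ⊗_A M^{⊗ k}`. -/
lemma isOrthogonalSum_iterate (hT : T.IsAdjointable) {R : IPMap (limit T) ((limit T).tensor M)}
    (hR : ∀ k x, R (ι T (k + 1) x) = (ι T k).tensor M x) (k : ℕ) :
    IsOrthogonalSum ((R.iterate k).comp (ι T k)) ((subZ T 0).incl.tensorPow M k)
      ((R.iterate k).comp (ι T (k + 1))) := by
  induction k with
  | zero =>
    exact
      { ip_eq_zero := fun x w => w.2.2 (ι T 0 x) ⟨x, rfl⟩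
        left_mem := fun x => subY_le_succ 0 ⟨x, rfl⟩
        right_mem := fun w => w.2.1
        exists_add := fun y => by
          obtain ⟨_, ⟨x, rfl⟩, q, hq, h⟩ := exists_add_of_mem_subY hT 0 ⟨y, rfl⟩
          exact ⟨x, ⟨q, hq⟩, h.symm⟩ }
  | succ k ih =>
    -- Taken at `j = k` and `j = k + 1`, this shows the outer two maps of the goal to be those of
    -- the induction hypothesis tensored with `M`. The middle one is so by definition.
    have e : ∀ j, (R.iterate (k + 1)).comp (ι T (j + 1)) =
        ((R.iterate k).comp (ι T j)).tensor M := fun j => by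
      rw [IPMap.tensor_comp, IPMap.iterate_succ_eq]
      exact IPMap.ext_fun fun x => congrArg ((R.iterate k).tensor M) (hR j x)
    rw [e, e]
    exact ih.tensor M

/-- Inside `R^k Y_{k+1}`, both `R^k Z_k` and `Z_0 ⊗ M^{⊗ k}` are the orthogonal complement of `R^k
Y_k`. One inclusion produces `φ` by factoring, the other its surjectivity. -/
lemma exists_iso_subZ (hT : T.IsAdjointable) {R : IPMap (limit T) ((limit T).tensor M)}
    (hR : ∀ k x, R (ι T (k + 1) x) = (ι T k).tensor M x) (k : ℕ) :
    ∃ φ : HilbertIso (subZ T k).toModule ((subZ T 0).toModule.tensorPow M k),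
      ∀ z, (subZ T 0).incl.tensorPow M k (φ z) = R.iterate k ((subZ T k).incl z) := by
  have h := isOrthogonalSum_iterate hT hR k
  have hinj : Function.Injective (R.iterate k) := (R.iterate k).isometry.injective
  obtain ⟨φ, hφ⟩ := ((R.iterate k).comp (subZ T k).incl).exists_factor
    ((subZ T 0).incl.tensorPow M k) fun z => by
      obtain ⟨y, hy⟩ := z.2.1
      obtain ⟨x, w, hxw⟩ := h.exists_add y
      have h1 : ι T (k + 1) y = (subZ T k).incl z := hy
      rw [IPMap.comp_apply, IPMap.comp_apply, h1] at hxw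
      -- In `R^k z = R^k ι^k x + w`, both `R^k z` and `w` are orthogonal to `R^k ι^k x`, which is
      -- therefore orthogonal to itself and vanishes.
      have h2 : ip (R.iterate k (ι T k x)) (R.iterate k ((subZ T k).incl z)) = 0 := by
        rw [IPMap.ip_map]; exact z.2.2 _ ⟨x, rfl⟩
      have h3 := h.ip_eq_zero x w
      rw [IPMap.comp_apply] at h3
      rw [← hxw, ip_add_right, h3, add_zero, ip_self_eq_zero] at h2
      rw [h2, zero_add] at hxw
      exact ⟨w, hxw⟩
  refine ⟨⟨φ, fun w => ?_⟩, hφ⟩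
  obtain ⟨y, hy⟩ := h.right_mem w
  have hy' : R.iterate k (ι T (k + 1) y) = (subZ T 0).incl.tensorPow M k w := hy
  -- `R^k` preserves inner products, so orthogonality of `w` to `R^k Y_k` pulls back to
  -- orthogonality of `ι^{k+1} y` to `Y_k`.
  have hz : ι T (k + 1) y ∈ subZ T k := by
    refine ⟨⟨y, rfl⟩, ?_⟩
    rintro _ ⟨x, rfl⟩
    rw [← (R.iterate k).ip_map, hy']
    exact h.ip_eq_zero x w
  refine ⟨⟨_, hz⟩, ((subZ T 0).incl.tensorPow M k).isometry.injective ?_⟩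
  exact (hφ _).trans hy

end MRA

end auxiliary

theorem mainTheorem2 {A : Type v} [NonUnitalCStarAlgebra A] [PartialOrder A] [StarOrderedRing A]
    (M : Correspondence.{u} A) (Y : HilbertModule.{u} A)
    (T : IPMap Y (Y.tensor M)) (hT : T.IsAdjointable) :
    -- `Y_k` is a complemented submodule of `Y_{k+1}`, with complement `Z_k`
    (∀ k, (∀ y ∈ MRA.subY T k, y ∈ MRA.subY T (k + 1)) ∧
      ∀ y ∈ MRA.subY T (k + 1), ∃ p ∈ MRA.subY T k, ∃ q ∈ MRA.subZ T k, y = p + q) ∧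
    -- `(y, (z_k)) ↦ y + ∑ z_k` is an isomorphism of `Y_0 ⊕ (⨁_k Z_k)` onto `Y_∞`
    (∃ S : HilbertIso (hilbertSum fun i => (MRA.summand T i).toModule) (MRA.limit T),
      ∀ w, HasSum (fun k : ℕ => (MRA.summand T (some k)).incl (hilbertSum.component w (some k)))
        (S w - (MRA.summand T none).incl (hilbertSum.component w none))) ∧
    -- there is exactly one isomorphism `R : Y_∞ → Y_∞ ⊗_A M` with `R ∘ ι^{k+1} = ι^k ⊗ id`,
    ∃ R : HilbertIso (MRA.limit T) ((MRA.limit T).tensor M),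
      (∀ k x, R (MRA.ι T (k + 1) x) = (MRA.ι T k).tensor M x) ∧
      (∀ R' : HilbertIso (MRA.limit T) ((MRA.limit T).tensor M),
        (∀ k x, R' (MRA.ι T (k + 1) x) = (MRA.ι T k).tensor M x) → R' = R) ∧
      -- and the isomorphism `R^k` restricts to an isomorphism of `Z_k` onto `Z_0 ⊗_A M^{⊗ k}`
      ∀ k, Function.Surjective (R.toIPMap.iterate k) ∧
        ∃ φ : HilbertIso (MRA.subZ T k).toModule ((MRA.subZ T 0).toModule.tensorPow M k),
          ∀ z, (MRA.subZ T 0).incl.tensorPow M k (φ z) =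
            R.toIPMap.iterate k ((MRA.subZ T k).incl z) := by
  refine ⟨fun k => ⟨fun y hy => MRA.subY_le_succ k hy,
    fun y hy => MRA.exists_add_of_mem_subY hT k hy⟩, MRA.exists_decomposition hT, ?_⟩
  obtain ⟨R, hR⟩ := MRA.exists_shift T
  exact ⟨R, hR, fun R' hR' => MRA.shift_unique hR hR', fun k =>
    ⟨IPMap.iterate_surjective R.surjective' k, MRA.exists_iso_subZ hT hR k⟩⟩
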